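/- Let $d\in\mathbb N$, $G\in C^4(\mathbb R^d;\mathbb R^d)$, $V_0\in C^2(\mathbb R^d;\mathbb R)$ and $x^\dagger,\eta\in\mathbb R^d$ (the truth and a fixed noise realization). Assume that $V_0\ge 0$ and $\int_{\mathbb R^d} e^{-V_0(x)}\,dx<\infty$, that there is a constant $M$ with $|G(x)|^2\le M e^{|x|^2}$ and $V_0(x)\le M e^{|x|^2}$ for all $x$, and that $G$ does not return to $G(x^\dagger)$ at infinity: there are $R\in\mathbb R$ and $c>0$ with $|G(x)-G(x^\dagger)|\ge c$ whenever $|x|\ge R$. For $N\ge 1$ let $\mu_N$ be the small-noise posterior, i.e. the probability measure on $\mathbb R^d$ $$\mu_N(dx)=\frac1{Z_N}\exp\Big(-\frac N2\Big|G(x^\dagger)-G(x)+\frac{1}{\sqrt N}\eta\Big|^2-V_0(x)\Big)\,dx ,$$ where $Z_N$ is the normalization constant. Let $D_{\mathrm{KL}}(\nu\|\mu)=\mathbb E^{\nu}\log\frac{d\nu}{d\mu}$ be the Kullback–Leibler divergence ($+\infty$ if $\nu\not\ll\mu$), let $N(m,\Sigma)$ be the Gaussian measure with mean $m$ and positive semidefinite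 covariance $\Sigma$, let $\mathcal A$ be the set of all these Gaussian measures on $\mathbb R^d$, and let $DG(x)$ be the Jacobian matrix of $G$ at $x$. (i) Suppose that $G(x)=G(x^\dagger)$ implies $x=x^\dagger$, and that $G$ is a $C^1$-diffeomorphism in a neighborhood of $x^\dagger$. For every $N\ge1$ let $\nu_N=N(m_N,\frac1N\Sigma_N)$ be a minimizer of $\nu\mapsto D_{\mathrm{KL}}(\nu\|\mu_N)$ within $\mathcal A$. Then, as $N\to\infty$, $$D_{\mathrm{KL}}(\nu_N\|\mu_N)\to0,\qquad m_N\to x^\dagger,\qquad \Sigma_N\to\big(DG(x^\dagger)^TDG(x^\dagger)\big)^{-1}.$$ (ii) Suppose that the solutions of $G(x)=G(x^\dagger)$ are exactly the $n$ distinct points $x_1^\dagger,\dots,x_n^\dagger$, and that $G$ is a $C^1$-diffeomorphism in a neighborhood of each $x_i^\dagger$. Put $$\beta_i=\frac{|\det DG(x_i^\dagger)|^{-1}e^{-V_0(x_i^\dagger)}}{\sum_{j=1}^n|\det DG(x_j^\dagger)|^{-1}e^{-V_0(x_j^\dagger)}} .$$ Let $0<\xi_1<1$ with $\xi_1\le\min_i\beta_i$,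 and let $\xi_2>0$ with $\xi_2<|x_i^\dagger-x_j^\dagger|$ for all $i\ne j$. Let $\mathcal M$ be the set of mixtures $\sum_{i=1}^n\alpha^iN(m^i,\Sigma^i)$ of Gaussian measures from $\mathcal A$ with $\sum_i\alpha^i=1$, $\alpha^i\ge\xi_1$ for all $i$, and $|m^i-m^j|\ge\xi_2$ for all $i\neq j$. For every $N\ge1$ let $\nu_N=\sum_{i=1}^n\alpha_N^iN(m_N^i,\frac1N\Sigma_N^i)$, with parameters of this kind, be a minimizer of $\nu\mapsto D_{\mathrm{KL}}(\nu\|\mu_N)$ within $\mathcal M$. Then, after relabelling the components of each $\nu_N$ by a suitable permutation of $\{1,\dots,n\}$ (which may depend on $N$), for every $i$, as $N\to\infty$, $$m_N^i\to x_i^\dagger,\qquad \Sigma_N^i\to\big(DG(x_i^\dagger)^TDG(x_i^\dagger)\big)^{-1},\qquad \alpha_N^i\to\beta_i .$$ -/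

import Mathlib

open MeasureTheory ProbabilityTheory InformationTheory Filter Topology
open scoped Manifold

namespace KLInverse

noncomputable section

/-- The data misfit `V₁^N(x) = ½ |G(x†) - G(x) + η / √N|²`. -/
def misfit {d : ℕ} (G : EuclideanSpace ℝ (Fin d) → EuclideanSpace ℝ (Fin d))
    (xt η : EuclideanSpace ℝ (Fin d)) (N : ℕ) (x : EuclideanSpace ℝ (Fin d)) : ℝ :=
  (1 / 2) * ‖G xt - G x + (1 / √(N : ℝ)) • η‖ ^ 2

/-- The unnormalised posterior density `exp (-N V₁^N(x) - V₀(x))`. -/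
def unnormalizedDensity {d : ℕ} (G : EuclideanSpace ℝ (Fin d) → EuclideanSpace ℝ (Fin d))
    (V₀ : EuclideanSpace ℝ (Fin d) → ℝ) (xt η : EuclideanSpace ℝ (Fin d)) (N : ℕ)
    (x : EuclideanSpace ℝ (Fin d)) : ℝ :=
  Real.exp (-((N : ℝ) * misfit G xt η N x) - V₀ x)

/-- The normalisation constant of the posterior. -/
def normalizationConst {d : ℕ} (G : EuclideanSpace ℝ (Fin d) → EuclideanSpace ℝ (Fin d))
    (V₀ : EuclideanSpace ℝ (Fin d) → ℝ) (xt η : EuclideanSpace ℝ (Fin d)) (N : ℕ) : ℝ :=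
  ∫ x, unnormalizedDensity G V₀ xt η N x

/-- The small-noise posterior of `x` given `y = G(x†) + η / √N`, for the prior with density
proportional to `exp (-V₀)` and standard normal `η`. -/
def smallNoisePosterior {d : ℕ} (G : EuclideanSpace ℝ (Fin d) → EuclideanSpace ℝ (Fin d))
    (V₀ : EuclideanSpace ℝ (Fin d) → ℝ) (xt η : EuclideanSpace ℝ (Fin d)) (N : ℕ) :
    Measure (EuclideanSpace ℝ (Fin d)) :=
  volume.withDensity fun x ↦
    ENNReal.ofReal ((normalizationConst G V₀ xt η N)⁻¹ * unnormalizedDensity G V₀ xt η N x)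

/-- The set of all Gaussian measures `N(m, S)` on `ℝ^d`, degenerate covariances included. -/
def gaussianMeasures (d : ℕ) : Set (Measure (EuclideanSpace ℝ (Fin d))) :=
  {ν | ∃ (m : EuclideanSpace ℝ (Fin d)) (S : Matrix (Fin d) (Fin d) ℝ),
    S.PosSemidef ∧ ν = multivariateGaussian m S}

/-- The mixture `∑ i, αⁱ N(mⁱ, Sⁱ)`. -/
def mixture {d n : ℕ} (α : Fin n → ℝ) (m : Fin n → EuclideanSpace ℝ (Fin d))
    (S : Fin n → Matrix (Fin d) (Fin d) ℝ) : Measure (EuclideanSpace ℝ (Fin d)) :=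
  ∑ i, ENNReal.ofReal (α i) • multivariateGaussian (m i) (S i)

/-- Parameters of a separated mixture: weights summing to one and all at least `ξ₁`, means at
mutual distance at least `ξ₂`, positive semidefinite covariances. -/
structure IsSeparated {d n : ℕ} (ξ₁ ξ₂ : ℝ) (α : Fin n → ℝ)
    (m : Fin n → EuclideanSpace ℝ (Fin d)) (S : Fin n → Matrix (Fin d) (Fin d) ℝ) : Prop where
  le_weight : ∀ i, ξ₁ ≤ α i
  sum_weight : ∑ i, α i = 1
  le_dist : ∀ i j, i ≠ j → ξ₂ ≤ ‖m i - m j‖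
  posSemidef : ∀ i, (S i).PosSemidef

/-- The set of separated mixtures of `n` Gaussian measures on `ℝ^d`. -/
def separatedMixtures (d n : ℕ) (ξ₁ ξ₂ : ℝ) : Set (Measure (EuclideanSpace ℝ (Fin d))) :=
  {ν | ∃ (α : Fin n → ℝ) (m : Fin n → EuclideanSpace ℝ (Fin d))
    (S : Fin n → Matrix (Fin d) (Fin d) ℝ), IsSeparated ξ₁ ξ₂ α m S ∧ ν = mixture α m S}

/-- `ν` minimises the Kullback-Leibler divergence `D(· ‖ μ)` within `𝒜`. -/
def IsBestApprox {d : ℕ} (𝒜 : Set (Measure (EuclideanSpace ℝ (Fin d))))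
    (μ ν : Measure (EuclideanSpace ℝ (Fin d))) : Prop :=
  ν ∈ 𝒜 ∧ IsMinOn (fun ρ ↦ klDiv ρ μ) 𝒜 ν

/-- The Jacobian matrix `DG(x)` in the standard basis. -/
def jacobian {d : ℕ} (G : EuclideanSpace ℝ (Fin d) → EuclideanSpace ℝ (Fin d))
    (x : EuclideanSpace ℝ (Fin d)) : Matrix (Fin d) (Fin d) ℝ :=
  LinearMap.toMatrix (EuclideanSpace.basisFun (Fin d) ℝ).toBasis
    (EuclideanSpace.basisFun (Fin d) ℝ).toBasis
    (fderiv ℝ G x : EuclideanSpace ℝ (Fin d) →ₗ[ℝ] EuclideanSpace ℝ (Fin d))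

/-- The limiting covariance `(DG(x)ᵀ DG(x))⁻¹`. -/
def limitCov {d : ℕ} (G : EuclideanSpace ℝ (Fin d) → EuclideanSpace ℝ (Fin d))
    (x : EuclideanSpace ℝ (Fin d)) : Matrix (Fin d) (Fin d) ℝ :=
  ((jacobian G x).transpose * jacobian G x)⁻¹

/-- The normalised weights proportional to `|det DG(xᵢ)|⁻¹ exp (-V₀(xᵢ))`. -/
def limitWeight {d n : ℕ} (G : EuclideanSpace ℝ (Fin d) → EuclideanSpace ℝ (Fin d))
    (V₀ : EuclideanSpace ℝ (Fin d) → ℝ) (x : Fin n → EuclideanSpace ℝ (Fin d)) (i : Fin n) : ℝ :=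
  (|(jacobian G (x i)).det|⁻¹ * Real.exp (-V₀ (x i))) /
    ∑ j, |(jacobian G (x j)).det|⁻¹ * Real.exp (-V₀ (x j))

end

end KLInverse

-- Everything follows from Laplace's method, one good competitor, and a soft form of Pinsker's
-- inequality.
--
-- Substitute `z = xᵢ + y/√N`, with `J = DG(xᵢ)`. The unnormalised posterior density converges to
-- `exp (-½‖J y - η‖² - V₀(xᵢ))`, a constant multiple of the density of the Gaussian with mean
-- `J⁻¹η` and covariance `(JᵀJ)⁻¹`. Away from the solutions the misfit is bounded below, so the
-- remaining mass is exponentially small. Hence `√N ^ d * Z_N` converges, the posterior mass near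
-- `xᵢ` tends to `βᵢ`, and the posterior rescaled there has a Gaussian limit
-- (`tendsto_normalizationConst`, `tendsto_setIntegral_posterior`).
--
-- The competitor is the mixture with exactly these limiting weights, means `xⱼ + J⁻¹η/√N` and
-- covariances `(JᵀJ)⁻¹/N`. In rescaled coordinates its log-ratio to the posterior tends to `0`
-- pointwise. The growth hypothesis dominates it by `K exp (ε‖y‖²)` for arbitrarily small `ε`, which
-- is integrable against the Gaussians. So its divergence vanishes (`tendsto_klDiv_competitor`). It
-- is eventually admissible, and therefore the divergence of the minimisers vanishes as well.
--
-- Consequently minimiser and posterior agree asymptotically on bounded test functions, even ones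
-- depending on `N`. Since every weight is at least `ξ₁`, each component must charge small balls
-- around the solutions, which makes its variance small and puts it near one solution
-- (`exists_concentrated`). The separation `ξ₂` makes this assignment injective (`exists_perm`).
-- Testing with characters at scale `1/√N`, cut off near `xₖ`, gives the limit of the weight times
-- the characteristic function of the `k`-th component: frequency `0` yields the weight, and the
-- modulus, which does not see the mean, yields the covariance (`exists_perm_tendsto`). A single
-- Gaussian is the case of one component.

namespace KLInverse

open Matrix

-- Gaussian densities parametrised by an invertible matrix

section GaussianDensity

variable {d : ℕ}

lemma map_toEuclideanCLM_volume {J : Matrix (Fin d) (Fin d) ℝ} (hJ : J.det ≠ 0) :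
    Measure.map (toEuclideanCLM (𝕜 := ℝ) J) (volume : Measure (EuclideanSpace ℝ (Fin d))) =
      ENNReal.ofReal |J.det|⁻¹ • volume := by
  have hdet : LinearMap.det (J.toEuclideanLin) = J.det := by
    rw [toEuclideanLin_eq_toLin_orthonormal, LinearMap.det_toLin]
  have h := Measure.map_linearMap_addHaar_eq_smul_addHaar
    (volume : Measure (EuclideanSpace ℝ (Fin d))) (f := J.toEuclideanLin) (by rwa [hdet])
  rw [hdet, abs_inv] at h
  exact h

lemma toEuclideanCLM_inv_apply {J : Matrix (Fin d) (Fin d) ℝ} (hJ : J.det ≠ 0)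
    (x : EuclideanSpace ℝ (Fin d)) :
    toEuclideanCLM (𝕜 := ℝ) J⁻¹ (toEuclideanCLM (𝕜 := ℝ) J x) = x := by
  rw [← mul_apply_eq_comp, ← map_mul,
    nonsing_inv_mul _ (isUnit_iff_ne_zero.2 hJ), map_one, one_apply_eq_self]

lemma toEuclideanCLM_apply_inv {J : Matrix (Fin d) (Fin d) ℝ} (hJ : J.det ≠ 0)
    (x : EuclideanSpace ℝ (Fin d)) :
    toEuclideanCLM (𝕜 := ℝ) J (toEuclideanCLM (𝕜 := ℝ) J⁻¹ x) = x := by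
  rw [← mul_apply_eq_comp, ← map_mul,
    mul_nonsing_inv _ (isUnit_iff_ne_zero.2 hJ), map_one, one_apply_eq_self]

lemma measurableEmbedding_toEuclideanCLM_sub {J : Matrix (Fin d) (Fin d) ℝ} (hJ : J.det ≠ 0)
    (w : EuclideanSpace ℝ (Fin d)) :
    MeasurableEmbedding fun y ↦ toEuclideanCLM (𝕜 := ℝ) J y - w := by
  have h1 : MeasurableEmbedding (toEuclideanCLM (𝕜 := ℝ) J) :=
    (LinearMap.isClosedEmbedding_of_injective (f := J.toEuclideanLin)
      (LinearMap.ker_eq_bot.2 (Function.LeftInverse.injective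
        (g := toEuclideanCLM (𝕜 := ℝ) J⁻¹) (toEuclideanCLM_inv_apply hJ)))).measurableEmbedding
  exact (measurableEmbedding_subRight w).comp h1

lemma map_toEuclideanCLM_sub_volume {J : Matrix (Fin d) (Fin d) ℝ} (hJ : J.det ≠ 0)
    (w : EuclideanSpace ℝ (Fin d)) :
    Measure.map (fun y ↦ toEuclideanCLM (𝕜 := ℝ) J y - w)
      (volume : Measure (EuclideanSpace ℝ (Fin d))) = ENNReal.ofReal |J.det|⁻¹ • volume := by
  have : (fun y ↦ toEuclideanCLM (𝕜 := ℝ) J y - w) =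
      (fun z ↦ z - w) ∘ toEuclideanCLM (𝕜 := ℝ) J := rfl
  rw [this, ← Measure.map_map (by fun_prop) (by fun_prop), map_toEuclideanCLM_volume hJ,
    Measure.map_smul, map_sub_right_eq_self]

lemma integral_comp_toEuclideanCLM_sub {F : Type*} [NormedAddCommGroup F] [NormedSpace ℝ F]
    {J : Matrix (Fin d) (Fin d) ℝ} (hJ : J.det ≠ 0) (w : EuclideanSpace ℝ (Fin d))
    (f : EuclideanSpace ℝ (Fin d) → F) :
    ∫ y, f (toEuclideanCLM (𝕜 := ℝ) J y - w) = |J.det|⁻¹ • ∫ z, f z := by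
  rw [← (measurableEmbedding_toEuclideanCLM_sub hJ w).integral_map,
    map_toEuclideanCLM_sub_volume hJ, integral_smul_measure, ENNReal.toReal_ofReal (by positivity)]

lemma integrable_comp_toEuclideanCLM_sub {F : Type*} [NormedAddCommGroup F]
    {J : Matrix (Fin d) (Fin d) ℝ} (hJ : J.det ≠ 0) (w : EuclideanSpace ℝ (Fin d))
    {f : EuclideanSpace ℝ (Fin d) → F} (hf : Integrable f) :
    Integrable fun y ↦ f (toEuclideanCLM (𝕜 := ℝ) J y - w) := by
  refine ((measurableEmbedding_toEuclideanCLM_sub hJ w).integrable_map_iff (g := f)).1 ?_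
  rw [map_toEuclideanCLM_sub_volume hJ]
  exact hf.smul_measure ENNReal.ofReal_ne_top

lemma integrable_exp_neg_mul_norm_sq {b : ℝ} (hb : 0 < b) :
    Integrable fun x : EuclideanSpace ℝ (Fin d) ↦ Real.exp (-(b * ‖x‖ ^ 2)) := by
  have h := (GaussianFourier.integrable_cexp_neg_mul_sq_norm_add
    (V := EuclideanSpace ℝ (Fin d)) (b := (b : ℂ)) (by simpa using hb) 0 0).norm
  refine h.congr (ae_of_all _ fun x ↦ ?_)
  simp only [Complex.norm_exp]
  norm_cast
  simp

/-- The density of the Gaussian measure with covariance `(JᵀJ)⁻¹` and mean `J⁻¹ w`. -/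
noncomputable def gaussianDensity (J : Matrix (Fin d) (Fin d) ℝ) (w y : EuclideanSpace ℝ (Fin d)) :
    ℝ :=
  |J.det| * ((2 * Real.pi) ^ ((d : ℝ) / 2))⁻¹ *
    Real.exp (-(1 / 2 * ‖toEuclideanCLM (𝕜 := ℝ) J y - w‖ ^ 2))

lemma gaussianDensity_pos {J : Matrix (Fin d) (Fin d) ℝ} (hJ : J.det ≠ 0)
    (w y : EuclideanSpace ℝ (Fin d)) : 0 < gaussianDensity J w y := by
  unfold gaussianDensity
  positivity

lemma continuous_gaussianDensity (J : Matrix (Fin d) (Fin d) ℝ) (w : EuclideanSpace ℝ (Fin d)) :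
    Continuous (gaussianDensity J w) := by
  unfold gaussianDensity
  fun_prop

lemma integrable_gaussianDensity {J : Matrix (Fin d) (Fin d) ℝ} (hJ : J.det ≠ 0)
    (w : EuclideanSpace ℝ (Fin d)) : Integrable (gaussianDensity J w) := by
  unfold gaussianDensity
  exact (integrable_comp_toEuclideanCLM_sub hJ w
    (integrable_exp_neg_mul_norm_sq (b := 1 / 2) (by norm_num))).const_mul _

lemma integral_gaussianDensity {J : Matrix (Fin d) (Fin d) ℝ} (hJ : J.det ≠ 0)
    (w : EuclideanSpace ℝ (Fin d)) : ∫ y, gaussianDensity J w y = 1 := by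
  unfold gaussianDensity
  rw [integral_const_mul, integral_comp_toEuclideanCLM_sub hJ w
    (f := fun z ↦ Real.exp (-(1 / 2 * ‖z‖ ^ 2)))]
  have h := GaussianFourier.integral_rexp_neg_mul_sq_norm
    (V := EuclideanSpace ℝ (Fin d)) (b := 1 / 2) (by norm_num)
  simp only [neg_mul] at h
  rw [h, finrank_euclideanSpace_fin, show Real.pi / (1 / 2) = 2 * Real.pi by ring]
  have h1 : |J.det| ≠ 0 := by positivity
  have h2 : (2 * Real.pi) ^ ((d : ℝ) / 2) ≠ 0 := by positivity
  simp only [smul_eq_mul]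
  field_simp

lemma posSemidef_inv_gram (J : Matrix (Fin d) (Fin d) ℝ) : (Jᵀ * J)⁻¹.PosSemidef := by
  have h := (posSemidef_conjTranspose_mul_self J).inv
  rwa [conjTranspose_eq_transpose_of_trivial] at h

/-- A Gaussian measure with covariance `(JᵀJ)⁻¹` has density `gaussianDensity`. -/
lemma multivariateGaussian_inv_gram {J : Matrix (Fin d) (Fin d) ℝ} (hJ : J.det ≠ 0)
    (m : EuclideanSpace ℝ (Fin d)) :
    multivariateGaussian m (Jᵀ * J)⁻¹ = volume.withDensity fun y ↦
      ENNReal.ofReal (gaussianDensity J (toEuclideanCLM (𝕜 := ℝ) J m) y) := by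
  set w := toEuclideanCLM (𝕜 := ℝ) J m with hw
  have : IsFiniteMeasure (volume.withDensity fun y ↦ ENNReal.ofReal (gaussianDensity J w y)) :=
    isFiniteMeasure_withDensity_ofReal (integrable_gaussianDensity hJ w).hasFiniteIntegral
  apply Measure.ext_of_charFun
  ext t
  rw [charFun_multivariateGaussian (posSemidef_inv_gram J), charFun_apply,
    integral_withDensity_eq_integral_toReal_smul
      (continuous_gaussianDensity J w).measurable.ennreal_ofReal (by simp)]
  simp_rw [ENNReal.toReal_ofReal (gaussianDensity_pos hJ w _).le]
  -- The substitution `z = J y - w` reduces the characteristic function to the Fourier transform of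
  -- the standard Gaussian at `u = J⁻ᵀ t`, and `‖u‖²` is the quadratic form of `(JᵀJ)⁻¹` at `t`.
  set u := toEuclideanCLM (𝕜 := ℝ) (J⁻¹)ᵀ t with hu
  have key : ∀ z, inner ℝ (toEuclideanCLM (𝕜 := ℝ) J⁻¹ z) t = inner ℝ u z := by
    intro z
    rw [hu, ← conjTranspose_eq_transpose_of_trivial, ← star_eq_conjTranspose, map_star,
      ContinuousLinearMap.star_eq_adjoint, ContinuousLinearMap.adjoint_inner_left,
      real_inner_comm]
  have hsq : t.ofLp ⬝ᵥ (Jᵀ * J)⁻¹ *ᵥ t.ofLp = ‖u‖ ^ 2 := by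
    rw [← inner_toEuclideanCLM, Matrix.mul_inv_rev, ← transpose_nonsing_inv, map_mul,
      mul_apply_eq_comp, real_inner_comm, key, ← hu, real_inner_self_eq_norm_sq]
  set f : EuclideanSpace ℝ (Fin d) → ℂ := fun z ↦
    ((|J.det| * ((2 * Real.pi) ^ ((d : ℝ) / 2))⁻¹ : ℝ) : ℂ) *
      Complex.exp (inner ℝ t m * Complex.I) *
      Complex.exp (-(1 / 2 : ℂ) * ‖z‖ ^ 2 + Complex.I * (inner ℝ u z : ℝ)) with hf
  have heq : ∀ y, gaussianDensity J w y • Complex.exp (inner ℝ y t * Complex.I) =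
      f (toEuclideanCLM (𝕜 := ℝ) J y - w) := by
    intro y
    have hy : inner ℝ y t = inner ℝ t m + inner ℝ u (toEuclideanCLM (𝕜 := ℝ) J y - w) := by
      rw [← key, map_sub, toEuclideanCLM_inv_apply hJ, hw, toEuclideanCLM_inv_apply hJ,
        inner_sub_left, real_inner_comm t m]
      ring
    simp only [gaussianDensity, Complex.real_smul, hf]
    rw [hy, mul_assoc (_ : ℂ) (Complex.exp _) (Complex.exp _), ← Complex.exp_add,
      Complex.ofReal_mul, mul_assoc, Complex.ofReal_exp, ← Complex.exp_add]
    congr 2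
    push_cast
    ring
  simp_rw [heq]
  rw [integral_comp_toEuclideanCLM_sub hJ w f, hf, integral_const_mul,
    GaussianFourier.integral_cexp_neg_mul_sq_norm_add (by norm_num), hsq,
    finrank_euclideanSpace_fin]
  have h1 : |J.det| ≠ 0 := by positivity
  have h2 : (2 * Real.pi) ^ ((d : ℝ) / 2) ≠ 0 := by positivity
  have h3 : ((Real.pi : ℂ) / (1 / 2)) ^ ((d : ℂ) / 2) =
      (((2 * Real.pi) ^ ((d : ℝ) / 2) : ℝ) : ℂ) := by
    rw [Complex.ofReal_cpow (by positivity)]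
    push_cast
    congr 1
    ring
  rw [h3, Complex.exp_sub, Complex.real_smul]
  have h4 : ((|J.det| : ℝ) : ℂ) ≠ 0 := by exact_mod_cast h1
  have h5 : (((2 * Real.pi) ^ ((d : ℝ) / 2) : ℝ) : ℂ) ≠ 0 := by exact_mod_cast h2
  push_cast at h4 h5 ⊢
  have h6 : Complex.exp (Complex.I ^ 2 * (‖u‖ : ℂ) ^ 2 / (4 * (1 / 2))) =
      (Complex.exp ((‖u‖ : ℂ) ^ 2 / 2))⁻¹ := by
    rw [← Complex.exp_neg, Complex.I_sq]
    congr 1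
    ring
  rw [h6]
  field_simp

end GaussianDensity

-- Kullback-Leibler divergence: densities and a Pinsker-type bound

section KullbackLeibler

variable {α : Type*} {mα : MeasurableSpace α}

/-- The first measure has density `p / q` with respect to the second, so `llr` is `log (p / q)`
almost everywhere; equality of the total masses cancels the mass terms in `klDiv`. -/
lemma klDiv_withDensity_ofReal {μ₀ : Measure α} [SigmaFinite μ₀] {p q : α → ℝ}
    (hp : Measurable p) (hq : Measurable q) (hp0 : ∀ x, 0 < p x) (hq0 : ∀ x, 0 < q x)
    (hp1 : Integrable p μ₀) (hq1 : Integrable q μ₀)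
    (hpi : ∫ x, p x ∂μ₀ = ∫ x, q x ∂μ₀)
    (hpq : Integrable (fun x ↦ p x * Real.log (p x / q x)) μ₀) :
    klDiv (μ₀.withDensity fun x ↦ ENNReal.ofReal (p x))
      (μ₀.withDensity fun x ↦ ENNReal.ofReal (q x)) =
      ENNReal.ofReal (∫ x, p x * Real.log (p x / q x) ∂μ₀) := by
  set ν := μ₀.withDensity fun x ↦ ENNReal.ofReal (p x) with hν
  set μ := μ₀.withDensity fun x ↦ ENNReal.ofReal (q x) with hμ
  have : IsFiniteMeasure ν := isFiniteMeasure_withDensity_ofReal hp1.hasFiniteIntegral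
  have : IsFiniteMeasure μ := isFiniteMeasure_withDensity_ofReal hq1.hasFiniteIntegral
  have hνμ : ν = μ.withDensity fun x ↦ ENNReal.ofReal (p x / q x) := by
    rw [hμ, ← withDensity_mul (g := fun x ↦ ENNReal.ofReal (p x / q x)) _ hq.ennreal_ofReal
      (hp.div hq).ennreal_ofReal, hν]
    congr 1
    ext x
    rw [Pi.mul_apply, ← ENNReal.ofReal_mul (hq0 x).le, mul_div_cancel₀ _ (hq0 x).ne']
  have hac : ν ≪ μ := hνμ ▸ withDensity_absolutelyContinuous _ _
  have hllr : llr ν μ =ᵐ[ν] fun x ↦ Real.log (p x / q x) := by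
    have h1 : ν.rnDeriv μ =ᵐ[μ] fun x ↦ ENNReal.ofReal (p x / q x) := by
      conv_lhs => rw [hνμ]
      exact Measure.rnDeriv_withDensity _ (hp.div hq).ennreal_ofReal
    filter_upwards [hac.ae_le h1] with x hx
    rw [llr, hx, ENNReal.toReal_ofReal (div_pos (hp0 x) (hq0 x)).le]
  have hint : Integrable (llr ν μ) ν := by
    rw [integrable_congr hllr, hν, integrable_withDensity_iff_integrable_smul' hp.ennreal_ofReal
      (by simp)]
    simpa [ENNReal.toReal_ofReal (hp0 _).le] using hpq
  rw [klDiv_of_ac_of_integrable hac hint, integral_congr_ae hllr, hν,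
    integral_withDensity_eq_integral_toReal_smul hp.ennreal_ofReal (by simp)]
  have hu : ∀ r : α → ℝ, Integrable r μ₀ → (∀ x, 0 < r x) →
      (μ₀.withDensity fun x ↦ ENNReal.ofReal (r x)).real Set.univ = ∫ x, r x ∂μ₀ := by
    intro r hr hr0
    rw [measureReal_def, withDensity_apply _ MeasurableSet.univ, Measure.restrict_univ,
      ← ofReal_integral_eq_lintegral_ofReal hr (ae_of_all _ fun x ↦ (hr0 x).le),
      ENNReal.toReal_ofReal (integral_nonneg fun x ↦ (hr0 x).le)]
  rw [hu p hp1 hp0, hμ, hu q hq1 hq0, hpi]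
  simp [ENNReal.toReal_ofReal (hp0 _).le]

/-- This is `log u ≤ u - 1` at `u = 1/√x`, multiplied by `2x`: the pointwise form of bounding the
Hellinger distance by the divergence. -/
lemma sq_sqrt_sub_one_le_klFun {x : ℝ} (hx : 0 ≤ x) : (√x - 1) ^ 2 ≤ klFun x := by
  rcases hx.eq_or_lt with rfl | hx
  · simp [klFun]
  have hs : 0 < √x := Real.sqrt_pos.2 hx
  have h1 : Real.log (√x)⁻¹ ≤ (√x)⁻¹ - 1 := Real.log_le_sub_one_of_pos (by positivity)
  rw [Real.log_inv, Real.log_sqrt hx.le] at h1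
  have h2 : x * (-(Real.log x / 2)) ≤ x * ((√x)⁻¹ - 1) := by gcongr
  have h3 : x * (√x)⁻¹ = √x := by
    rw [← div_eq_mul_inv, Real.div_sqrt]
  have h4 : √x ^ 2 = x := Real.sq_sqrt hx.le
  rw [klFun]
  nlinarith

/-- Factor `|x - 1| = |√x - 1| (√x + 1)` and apply Young's inequality with parameter `ε`. After
integration against a probability measure the last term becomes `2ε`. -/
lemma abs_sub_one_le_klFun {x ε : ℝ} (hx : 0 ≤ x) (hε : 0 < ε) :
    |x - 1| ≤ (2 * ε)⁻¹ * klFun x + ε * (x + 1) := by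
  have h4 : √x ^ 2 = x := Real.sq_sqrt hx
  have h0 := Real.sqrt_nonneg x
  have h1 : |x - 1| = |√x - 1| * (√x + 1) := by
    rw [← abs_of_nonneg (by positivity : 0 ≤ √x + 1), ← abs_mul]
    congr 1
    linear_combination -h4
  have h2 : |√x - 1| * (√x + 1) ≤ (2 * ε)⁻¹ * (√x - 1) ^ 2 + ε / 2 * (√x + 1) ^ 2 := by
    rw [← sq_abs (√x - 1)]
    have : (2 * ε)⁻¹ * |√x - 1| ^ 2 + ε / 2 * (√x + 1) ^ 2 - |√x - 1| * (√x + 1) =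
        (2 * ε)⁻¹ * (|√x - 1| - ε * (√x + 1)) ^ 2 := by
      field_simp
      ring
    have : 0 ≤ (2 * ε)⁻¹ * (|√x - 1| - ε * (√x + 1)) ^ 2 := by positivity
    linarith
  have h3 : (2 * ε)⁻¹ * (√x - 1) ^ 2 ≤ (2 * ε)⁻¹ * klFun x := by
    gcongr
    exact sq_sqrt_sub_one_le_klFun hx
  have h5 : (√x + 1) ^ 2 ≤ 2 * (x + 1) := by nlinarith [sq_nonneg (√x - 1)]
  have h6 : ε / 2 * (√x + 1) ^ 2 ≤ ε / 2 * (2 * (x + 1)) := by gcongr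
  linarith

/-- A weak form of Pinsker's inequality. -/
lemma norm_integral_sub_integral_le_klDiv {μ ν : Measure α} [IsProbabilityMeasure μ]
    [IsProbabilityMeasure ν] (hkl : klDiv ν μ ≠ ⊤) {h : α → ℂ} (hm : Measurable h)
    (hh : ∀ x, ‖h x‖ ≤ 1) {ε : ℝ} (hε : 0 < ε) :
    ‖∫ x, h x ∂ν - ∫ x, h x ∂μ‖ ≤ (2 * ε)⁻¹ * (klDiv ν μ).toReal + 2 * ε := by
  obtain ⟨hac, hint⟩ := klDiv_ne_top_iff.1 hkl
  set f : α → ℝ := fun x ↦ (ν.rnDeriv μ x).toReal with hf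
  have hf0 : ∀ x, 0 ≤ f x := fun x ↦ ENNReal.toReal_nonneg
  have hfi : Integrable f μ := Measure.integrable_toReal_rnDeriv
  have hki : Integrable (fun x ↦ klFun (f x)) μ := (integrable_klFun_rnDeriv_iff hac).2 hint
  have hhi : Integrable h μ :=
    (integrable_const (1 : ℝ)).mono' hm.aestronglyMeasurable (ae_of_all _ hh)
  have hfhi : Integrable (fun x ↦ f x • h x) μ := by
    refine hfi.mono' (hfi.aestronglyMeasurable.smul hm.aestronglyMeasurable)
      (ae_of_all _ fun x ↦ ?_)
    rw [norm_smul, Real.norm_of_nonneg (hf0 x)]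
    exact mul_le_of_le_one_right (hf0 x) (hh x)
  rw [← integral_rnDeriv_smul hac, ← integral_sub hfhi hhi]
  have hf1 : Integrable (fun x ↦ f x + 1) μ := hfi.add (integrable_const 1)
  have hb : Integrable (fun x ↦ (2 * ε)⁻¹ * klFun (f x) + ε * (f x + 1)) μ :=
    (hki.const_mul _).add (hf1.const_mul _)
  refine (norm_integral_le_of_norm_le hb (ae_of_all _ fun x ↦ ?_)).trans_eq ?_
  · have : f x • h x - h x = (f x - 1) • h x := by rw [sub_smul, one_smul]
    rw [this, norm_smul, Real.norm_eq_abs]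
    exact (mul_le_of_le_one_right (abs_nonneg _) (hh x)).trans (abs_sub_one_le_klFun (hf0 x) hε)
  · rw [integral_add (hki.const_mul _) (hf1.const_mul _),
      integral_const_mul, integral_const_mul, integral_add hfi (integrable_const 1),
      Measure.integral_toReal_rnDeriv hac, toReal_klDiv_eq_integral_klFun hac]
    simp
    ring

/-- The Pinsker-type bound is uniform over test functions of norm at most one, so they may vary with
`N`; this permits testing at the scale `1/√N`. -/
lemma tendsto_integral_sub_integral_of_klDiv {μ ν : ℕ → Measure α}
    (hμ : ∀ᶠ N in atTop, IsProbabilityMeasure (μ N))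
    (hν : ∀ᶠ N in atTop, IsProbabilityMeasure (ν N))
    (hkl : Tendsto (fun N ↦ klDiv (ν N) (μ N)) atTop (𝓝 0)) {h : ℕ → α → ℂ}
    (hm : ∀ N, Measurable (h N)) (hh : ∀ N x, ‖h N x‖ ≤ 1) :
    Tendsto (fun N ↦ ∫ x, h N x ∂ν N - ∫ x, h N x ∂μ N) atTop (𝓝 0) := by
  rw [Metric.tendsto_atTop']
  intro δ hδ
  have hkl' : Tendsto (fun N ↦ (klDiv (ν N) (μ N)).toReal) atTop (𝓝 0) :=
    (ENNReal.tendsto_toReal ENNReal.zero_ne_top).comp hkl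
  have hε : 0 < δ / 4 := by positivity
  have h2 : Tendsto (fun N ↦ (2 * (δ / 4))⁻¹ * (klDiv (ν N) (μ N)).toReal + 2 * (δ / 4)) atTop
      (𝓝 (δ / 2)) := by
    have := (hkl'.const_mul (2 * (δ / 4))⁻¹).add_const (2 * (δ / 4))
    convert this using 2
    ring
  have hev := (h2.eventually_lt_const (by linarith : δ / 2 < δ)).and
    ((hkl.eventually_lt_const ENNReal.zero_lt_top).and (hμ.and hν))
  obtain ⟨N₀, hN₀⟩ := eventually_atTop.1 hev
  refine ⟨N₀, fun N hN ↦ ?_⟩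
  obtain ⟨ha, hb, hc, hd⟩ := hN₀ N hN.le
  rw [dist_zero_right]
  exact (norm_integral_sub_integral_le_klDiv hb.ne (hm N) (hh N) hε).trans_lt ha

end KullbackLeibler

-- Local behaviour of the forward map and pointwise density bounds

variable {d n : ℕ} {G : EuclideanSpace ℝ (Fin d) → EuclideanSpace ℝ (Fin d)}
  {V₀ : EuclideanSpace ℝ (Fin d) → ℝ} {xt η : EuclideanSpace ℝ (Fin d)}
  {x : Fin n → EuclideanSpace ℝ (Fin d)}

lemma half_norm_sq_sub_le {F : Type*} [NormedAddCommGroup F] (a b : F) :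
    1 / 2 * ‖a‖ ^ 2 - ‖b‖ ^ 2 ≤ ‖a + b‖ ^ 2 := by
  have h : ‖a‖ ≤ ‖a + b‖ + ‖b‖ := by simpa using norm_sub_le (a + b) b
  nlinarith [norm_nonneg a, norm_nonneg b, norm_nonneg (a + b), sq_nonneg (‖a + b‖ - ‖b‖)]

lemma norm_add_sq_le {F : Type*} [NormedAddCommGroup F] (a b : F) :
    ‖a + b‖ ^ 2 ≤ 2 * ‖a‖ ^ 2 + 2 * ‖b‖ ^ 2 := by
  have h := norm_add_le a b
  nlinarith [norm_nonneg a, norm_nonneg b, norm_nonneg (a + b), sq_nonneg (‖a‖ - ‖b‖)]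

lemma pow_mul_integral_eq_integral_comp {F : Type*} [NormedAddCommGroup F] [NormedSpace ℝ F]
    {s : ℝ} (hs : 0 < s) (x₀ : EuclideanSpace ℝ (Fin d)) (f : EuclideanSpace ℝ (Fin d) → F) :
    s ^ d • ∫ z, f z = ∫ y, f (x₀ + s⁻¹ • y) := by
  rw [Measure.integral_comp_smul volume (fun z ↦ f (x₀ + z)), integral_add_left_eq_self f,
    finrank_euclideanSpace_fin, inv_pow, inv_inv, abs_of_pos (by positivity)]

lemma toEuclideanCLM_jacobian (G : EuclideanSpace ℝ (Fin d) → EuclideanSpace ℝ (Fin d))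
    (z : EuclideanSpace ℝ (Fin d)) : toEuclideanCLM (𝕜 := ℝ) (jacobian G z) = fderiv ℝ G z := by
  have h : (jacobian G z).toEuclideanLin =
      (fderiv ℝ G z : EuclideanSpace ℝ (Fin d) →ₗ[ℝ] EuclideanSpace ℝ (Fin d)) := by
    rw [toEuclideanLin_eq_toLin_orthonormal, jacobian, toLin_toMatrix]
  ext1 v
  exact LinearMap.congr_fun h v

lemma hasFDerivAt_jacobian (hG : ContDiff ℝ 1 G) (z : EuclideanSpace ℝ (Fin d)) :
    HasFDerivAt G (toEuclideanCLM (𝕜 := ℝ) (jacobian G z)) z := by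
  rw [toEuclideanCLM_jacobian]
  exact (hG.differentiable one_ne_zero z).hasFDerivAt

lemma exists_le_norm_toEuclideanCLM {J : Matrix (Fin d) (Fin d) ℝ} (hJ : J.det ≠ 0) :
    ∃ κ > 0, ∀ y, κ * ‖y‖ ≤ ‖toEuclideanCLM (𝕜 := ℝ) J y‖ := by
  set C := ‖toEuclideanCLM (𝕜 := ℝ) J⁻¹‖ + 1
  have hC : 0 < C := by positivity
  refine ⟨C⁻¹, by positivity, fun y ↦ ?_⟩
  rw [inv_mul_le_iff₀ hC]
  calc ‖y‖ = ‖toEuclideanCLM (𝕜 := ℝ) J⁻¹ (toEuclideanCLM (𝕜 := ℝ) J y)‖ := by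
        rw [toEuclideanCLM_inv_apply hJ]
    _ ≤ ‖toEuclideanCLM (𝕜 := ℝ) J⁻¹‖ * ‖toEuclideanCLM (𝕜 := ℝ) J y‖ :=
        ContinuousLinearMap.le_opNorm _ _
    _ ≤ C * ‖toEuclideanCLM (𝕜 := ℝ) J y‖ := by
        gcongr
        exact (lt_add_one _).le

/-- An invertible derivative expands by at least some `κ`, and near `z` the linearisation error uses
up at most half of that. -/
lemma exists_mul_norm_le_norm_sub {J : Matrix (Fin d) (Fin d) ℝ} (hJ : J.det ≠ 0)
    {z : EuclideanSpace ℝ (Fin d)} (hG : HasFDerivAt G (toEuclideanCLM (𝕜 := ℝ) J) z) :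
    ∃ κ > 0, ∀ᶠ r in 𝓝[>] (0 : ℝ), ∀ h, ‖h‖ < r → κ * ‖h‖ ≤ ‖G (z + h) - G z‖ := by
  obtain ⟨κ, hκ, hle⟩ := exists_le_norm_toEuclideanCLM hJ
  refine ⟨κ / 2, by positivity, ?_⟩
  have h1 := (hasFDerivAt_iff_isLittleO_nhds_zero.1 hG).def (half_pos hκ)
  obtain ⟨ε, hε, hball⟩ := Metric.eventually_nhds_iff.1 h1
  filter_upwards [Ioo_mem_nhdsGT hε] with r hr h hh
  have h2 := hball (show dist h 0 < ε by rw [dist_zero_right]; exact hh.trans hr.2)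
  have h3 := norm_sub_norm_le (toEuclideanCLM (𝕜 := ℝ) J h) (-(G (z + h) - G z -
    toEuclideanCLM (𝕜 := ℝ) J h))
  rw [norm_neg, sub_neg_eq_add, add_sub_cancel] at h3
  linarith [hle h]

lemma exists_norm_sub_le_mul_norm {A : EuclideanSpace ℝ (Fin d) →L[ℝ] EuclideanSpace ℝ (Fin d)}
    {z : EuclideanSpace ℝ (Fin d)} (hG : HasFDerivAt G A z) :
    ∃ r > 0, ∃ L > 0, ∀ h, ‖h‖ < r → ‖G (z + h) - G z‖ ≤ L * ‖h‖ := by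
  have h1 := (hasFDerivAt_iff_isLittleO_nhds_zero.1 hG).def one_pos
  obtain ⟨ε, hε, hball⟩ := Metric.eventually_nhds_iff.1 h1
  refine ⟨ε, hε, ‖A‖ + 1, by positivity, fun h hh ↦ ?_⟩
  have h2 := hball (show dist h 0 < ε by rwa [dist_zero_right])
  have h3 := norm_add_le (G (z + h) - G z - A h) (A h)
  rw [sub_add_cancel] at h3
  linarith [A.le_opNorm h]

lemma tendsto_smul_sub {A : EuclideanSpace ℝ (Fin d) →L[ℝ] EuclideanSpace ℝ (Fin d)}
    {z : EuclideanSpace ℝ (Fin d)} (hG : HasFDerivAt G A z) (y : EuclideanSpace ℝ (Fin d)) :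
    Tendsto (fun N : ℕ ↦ √(N : ℝ) • (G z - G (z + (√(N : ℝ))⁻¹ • y))) atTop (𝓝 (-A y)) := by
  have hs : Tendsto (fun N : ℕ ↦ ‖√(N : ℝ)‖) atTop atTop :=
    tendsto_norm_atTop_atTop.comp (Real.tendsto_sqrt_atTop.comp tendsto_natCast_atTop_atTop)
  convert (hG.lim y hs).neg using 2 with N
  rw [← smul_neg, neg_sub]

lemma tendsto_add_inv_sqrt_smul (z y : EuclideanSpace ℝ (Fin d)) :
    Tendsto (fun N : ℕ ↦ z + (√(N : ℝ))⁻¹ • y) atTop (𝓝 z) := by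
  have hs : Tendsto (fun N : ℕ ↦ (√(N : ℝ))⁻¹) atTop (𝓝 0) :=
    tendsto_inv_atTop_zero.comp (Real.tendsto_sqrt_atTop.comp tendsto_natCast_atTop_atTop)
  simpa using (hs.smul_const y).const_add z

lemma unnormalizedDensity_eq {N : ℕ} (hN : 1 ≤ N) (z : EuclideanSpace ℝ (Fin d)) :
    unnormalizedDensity G V₀ xt η N z =
      Real.exp (-(1 / 2 * ‖√(N : ℝ) • (G xt - G z) + η‖ ^ 2) - V₀ z) := by
  have hN0 : (0 : ℝ) < N := by exact_mod_cast hN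
  have hs : 0 < √(N : ℝ) := Real.sqrt_pos.2 hN0
  have h : √(N : ℝ) • (G xt - G z) + η =
      √(N : ℝ) • (G xt - G z + (1 / √(N : ℝ)) • η) := by
    rw [smul_add, smul_smul, mul_one_div_cancel hs.ne', one_smul]
  rw [unnormalizedDensity, misfit, h, norm_smul, mul_pow, Real.norm_of_nonneg hs.le,
    Real.sq_sqrt hN0.le]
  congr 1
  ring

lemma unnormalizedDensity_pos (N : ℕ) (z : EuclideanSpace ℝ (Fin d)) :
    0 < unnormalizedDensity G V₀ xt η N z := Real.exp_pos _

lemma unnormalizedDensity_le (N : ℕ) (z : EuclideanSpace ℝ (Fin d)) :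
    unnormalizedDensity G V₀ xt η N z ≤ Real.exp (-V₀ z) := by
  refine Real.exp_le_exp.2 ?_
  have : 0 ≤ (N : ℝ) * misfit G xt η N z := by unfold misfit; positivity
  linarith

/-- The noise is split off by `½‖a‖² - ‖b‖² ≤ ‖a + b‖²`, at the price of the constant `exp (‖η‖² /
2)` and of halving the exponent. -/
lemma unnormalizedDensity_le_of_le {N : ℕ} (hN : 1 ≤ N) {z : EuclideanSpace ℝ (Fin d)} {c : ℝ}
    (hc : 0 ≤ c) (h : c ≤ √(N : ℝ) * ‖G z - G xt‖) :
    unnormalizedDensity G V₀ xt η N z ≤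
      Real.exp (‖η‖ ^ 2 / 2) * Real.exp (-(1 / 4 * c ^ 2)) * Real.exp (-V₀ z) := by
  rw [unnormalizedDensity_eq hN, ← Real.exp_add, ← Real.exp_add, Real.exp_le_exp]
  have h1 := half_norm_sq_sub_le (√(N : ℝ) • (G xt - G z)) η
  rw [norm_smul, Real.norm_of_nonneg (Real.sqrt_nonneg _), norm_sub_rev] at h1
  have h2 : c ^ 2 ≤ (√(N : ℝ) * ‖G z - G xt‖) ^ 2 := by gcongr
  linarith

lemma continuous_unnormalizedDensity (hG : Continuous G) (hV : Continuous V₀) (N : ℕ) :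
    Continuous (unnormalizedDensity G V₀ xt η N) := by
  unfold unnormalizedDensity misfit
  fun_prop

/-- Assumptions on the inverse problem with solutions `x₁, …, xₙ` of `G(x) = G(x†)`. -/
structure IsMultiwell (G : EuclideanSpace ℝ (Fin d) → EuclideanSpace ℝ (Fin d))
    (V₀ : EuclideanSpace ℝ (Fin d) → ℝ) (xt : EuclideanSpace ℝ (Fin d))
    (x : Fin n → EuclideanSpace ℝ (Fin d)) : Prop where
  contDiff : ContDiff ℝ 1 G
  continuous : Continuous V₀
  nonneg : ∀ z, 0 ≤ V₀ z
  integrable : Integrable fun z ↦ Real.exp (-V₀ z)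
  growth : ∃ M : ℝ, ∀ z, ‖G z‖ ^ 2 ≤ M * Real.exp (‖z‖ ^ 2) ∧ V₀ z ≤ M * Real.exp (‖z‖ ^ 2)
  infty : ∃ R c : ℝ, 0 < c ∧ ∀ z, R ≤ ‖z‖ → c ≤ ‖G z - G xt‖
  injective : Function.Injective x
  eq_iff : ∀ z, G z = G xt ↔ ∃ i, x i = z
  det_ne_zero : ∀ i, (jacobian G (x i)).det ≠ 0

-- The posterior measure and Laplace's method

namespace IsMultiwell

lemma apply_eq (h : IsMultiwell G V₀ xt x) (i : Fin n) : G (x i) = G xt :=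
  (h.eq_iff _).2 ⟨i, rfl⟩

lemma integrable_unnormalizedDensity (h : IsMultiwell G V₀ xt x) (η : EuclideanSpace ℝ (Fin d))
    (N : ℕ) : Integrable (unnormalizedDensity G V₀ xt η N) := by
  refine h.integrable.mono'
    (continuous_unnormalizedDensity h.contDiff.continuous h.continuous N).aestronglyMeasurable
    (ae_of_all _ fun z ↦ ?_)
  rw [Real.norm_of_nonneg (unnormalizedDensity_pos N z).le]
  exact unnormalizedDensity_le N z

lemma normalizationConst_pos (h : IsMultiwell G V₀ xt x) (η : EuclideanSpace ℝ (Fin d)) (N : ℕ) :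
    0 < normalizationConst G V₀ xt η N := by
  rw [normalizationConst, integral_pos_iff_support_of_nonneg
    (fun z ↦ (unnormalizedDensity_pos N z).le) (h.integrable_unnormalizedDensity η N)]
  have : Function.support (unnormalizedDensity G V₀ xt η N) = Set.univ :=
    Set.eq_univ_of_forall fun z ↦ (unnormalizedDensity_pos N z).ne'
  rw [this]
  exact isOpen_univ.measure_pos volume Set.univ_nonempty

lemma isProbabilityMeasure (h : IsMultiwell G V₀ xt x) (η : EuclideanSpace ℝ (Fin d)) (N : ℕ) :
    IsProbabilityMeasure (smallNoisePosterior G V₀ xt η N) := by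
  have hZ := h.normalizationConst_pos η N
  constructor
  rw [smallNoisePosterior, withDensity_apply _ MeasurableSet.univ, Measure.restrict_univ,
    ← ofReal_integral_eq_lintegral_ofReal ((h.integrable_unnormalizedDensity η N).const_mul _)
      (ae_of_all _ fun z ↦ mul_nonneg (inv_nonneg.2 hZ.le) (unnormalizedDensity_pos N z).le),
    integral_const_mul, ← normalizationConst, inv_mul_cancel₀ hZ.ne', ENNReal.ofReal_one]

lemma setIntegral_posterior (h : IsMultiwell G V₀ xt x) (η : EuclideanSpace ℝ (Fin d)) (N : ℕ)
    {A : Set (EuclideanSpace ℝ (Fin d))} (hA : MeasurableSet A)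
    (ψ : EuclideanSpace ℝ (Fin d) → ℂ) :
    ∫ z in A, ψ z ∂smallNoisePosterior G V₀ xt η N =
      (normalizationConst G V₀ xt η N)⁻¹ •
        ∫ z in A, unnormalizedDensity G V₀ xt η N z • ψ z := by
  have hZ := h.normalizationConst_pos η N
  have hc := continuous_unnormalizedDensity (xt := xt) (η := η) h.contDiff.continuous h.continuous N
  rw [smallNoisePosterior, restrict_withDensity hA, integral_withDensity_eq_integral_toReal_smul
    (by fun_prop) (by simp), ← integral_smul]
  refine integral_congr_ae (ae_of_all _ fun z ↦ ?_)
  simp only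
  rw [ENNReal.toReal_ofReal
    (mul_nonneg (inv_nonneg.2 hZ.le) (unnormalizedDensity_pos N z).le), smul_smul]

/-- Laplace's method near one of the solutions. -/
lemma tendsto_setIntegral_ball (h : IsMultiwell G V₀ xt x) (η : EuclideanSpace ℝ (Fin d))
    (i : Fin n) {r κ : ℝ} (hr : 0 < r) (hκ : 0 < κ)
    (hloc : ∀ v, ‖v‖ < r → κ * ‖v‖ ≤ ‖G (x i + v) - G (x i)‖)
    {ψ : EuclideanSpace ℝ (Fin d) → ℂ} (hψ : Measurable ψ) (hψ1 : ∀ y, ‖ψ y‖ ≤ 1) :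
    Tendsto (fun N : ℕ ↦ √(N : ℝ) ^ d • ∫ z in Metric.ball (x i) r,
        unnormalizedDensity G V₀ xt η N z • ψ (√(N : ℝ) • (z - x i))) atTop
      (𝓝 (∫ y, Real.exp (-(1 / 2 * ‖toEuclideanCLM (𝕜 := ℝ) (jacobian G (x i)) y - η‖ ^ 2) -
        V₀ (x i)) • ψ y)) := by
  -- Extended by zero outside the ball, the integrand lives on the whole space after rescaling, so
  -- dominated convergence applies on a fixed domain.
  set f : ℕ → EuclideanSpace ℝ (Fin d) → ℂ := fun N y ↦
    (Metric.ball (x i) r).indicator (fun z ↦ unnormalizedDensity G V₀ xt η N z •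
      ψ (√(N : ℝ) • (z - x i))) (x i + (√(N : ℝ))⁻¹ • y) with hf
  have hfN : ∀ᶠ N : ℕ in atTop, √(N : ℝ) ^ d • ∫ z in Metric.ball (x i) r,
      unnormalizedDensity G V₀ xt η N z • ψ (√(N : ℝ) • (z - x i)) = ∫ y, f N y := by
    filter_upwards [eventually_ge_atTop 1] with N hN
    have hs : 0 < √(N : ℝ) := Real.sqrt_pos.2 (by exact_mod_cast hN)
    rw [← integral_indicator measurableSet_ball, pow_mul_integral_eq_integral_comp hs (x i)]
  refine Tendsto.congr' (hfN.mono fun N hN ↦ hN.symm) ?_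
  refine tendsto_integral_filter_of_dominated_convergence
    (fun y ↦ Real.exp (‖η‖ ^ 2 / 2) * Real.exp (-(κ ^ 2 / 4 * ‖y‖ ^ 2))) ?_ ?_
    ((integrable_exp_neg_mul_norm_sq (by positivity)).const_mul _) (ae_of_all _ fun y ↦ ?_)
  · refine Eventually.of_forall fun N ↦ Measurable.aestronglyMeasurable ?_
    have hc := (continuous_unnormalizedDensity (xt := xt) (η := η)
      h.contDiff.continuous h.continuous N).measurable
    exact ((hc.smul (hψ.comp (by fun_prop))).indicator measurableSet_ball).comp (by fun_prop)
  · filter_upwards [eventually_ge_atTop 1] with N hN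
    refine ae_of_all _ fun y ↦ ?_
    have hs : 0 < √(N : ℝ) := Real.sqrt_pos.2 (by exact_mod_cast hN)
    simp only [hf]
    by_cases hy : x i + (√(N : ℝ))⁻¹ • y ∈ Metric.ball (x i) r
    · rw [Set.indicator_of_mem hy, norm_smul, Real.norm_of_nonneg (unnormalizedDensity_pos N _).le]
      rw [Metric.mem_ball, dist_eq_norm, add_sub_cancel_left] at hy
      have h1 := hloc _ hy
      rw [norm_smul, norm_inv, Real.norm_of_nonneg hs.le, h.apply_eq i] at h1
      -- The local expansion survives rescaling with a constant independent of `N`; this gives the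
      -- Gaussian dominating function.
      have h2 : κ * ‖y‖ ≤ √(N : ℝ) * ‖G (x i + (√(N : ℝ))⁻¹ • y) - G xt‖ := by
        calc κ * ‖y‖ = √(N : ℝ) * (κ * ((√(N : ℝ))⁻¹ * ‖y‖)) := by field_simp
          _ ≤ _ := by gcongr
      have h3 := unnormalizedDensity_le_of_le (V₀ := V₀) (η := η) hN (by positivity) h2
      refine (mul_le_of_le_one_right (unnormalizedDensity_pos N _).le (hψ1 _)).trans (h3.trans ?_)
      refine (mul_le_of_le_one_right (by positivity)
        (Real.exp_le_one_iff.2 (neg_nonpos.2 (h.nonneg _)))).trans_eq ?_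
      rw [mul_pow]
      ring_nf
    · rw [Set.indicator_of_notMem hy, norm_zero]
      positivity
  · have hz := tendsto_add_inv_sqrt_smul (x i) y
    have hmem := hz.eventually (Metric.ball_mem_nhds (x i) hr)
    have hd := tendsto_smul_sub (hasFDerivAt_jacobian h.contDiff (x i)) y
    have hlim : Tendsto (fun N : ℕ ↦ Real.exp (-(1 / 2 *
        ‖√(N : ℝ) • (G (x i) - G (x i + (√(N : ℝ))⁻¹ • y)) + η‖ ^ 2) -
        V₀ (x i + (√(N : ℝ))⁻¹ • y)) • ψ y) atTop
        (𝓝 (Real.exp (-(1 / 2 * ‖-toEuclideanCLM (𝕜 := ℝ) (jacobian G (x i)) y + η‖ ^ 2) -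
          V₀ (x i)) • ψ y)) := by
      refine Tendsto.smul_const ((Real.continuous_exp.tendsto _).comp (Tendsto.sub ?_ ?_)) _
      · exact (((hd.add_const η).norm.pow 2).const_mul _).neg
      · exact (h.continuous.tendsto _).comp hz
    rw [neg_add_eq_sub, norm_sub_rev] at hlim
    refine hlim.congr' ?_
    filter_upwards [hmem, eventually_ge_atTop 1] with N hy hN
    have hs : 0 < √(N : ℝ) := Real.sqrt_pos.2 (by exact_mod_cast hN)
    have hy' : √(N : ℝ) • (x i + (√(N : ℝ))⁻¹ • y - x i) = y := by
      rw [add_sub_cancel_left, smul_smul, mul_inv_cancel₀ hs.ne', one_smul]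
    simp only [hf]
    rw [Set.indicator_of_mem (Metric.mem_ball.2 hy), unnormalizedDensity_eq hN, hy', h.apply_eq i]

/-- A uniform lower bound for the misfit away from the solutions. -/
lemma exists_le_norm_sub (h : IsMultiwell G V₀ xt x) {r : ℝ} (hr : 0 < r) :
    ∃ c > 0, ∀ z, z ∉ ⋃ i, Metric.ball (x i) r → c ≤ ‖G z - G xt‖ := by
  obtain ⟨R, c, hc, hR⟩ := h.infty
  -- Beyond radius `R` the bound is the hypothesis at infinity. What remains is compact and contains
  -- no solution, so the misfit attains a positive minimum there.
  set K := Metric.closedBall (0 : EuclideanSpace ℝ (Fin d)) R \ ⋃ i, Metric.ball (x i) r with hK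
  have hKc : IsCompact K :=
    (isCompact_closedBall _ _).diff (isOpen_iUnion fun _ ↦ Metric.isOpen_ball)
  have hcont : ContinuousOn (fun z ↦ ‖G z - G xt‖) K := by
    have := h.contDiff.continuous
    fun_prop
  have hK' : ∃ c' > 0, ∀ z ∈ K, c' ≤ ‖G z - G xt‖ := by
    rcases K.eq_empty_or_nonempty with hE | hne
    · exact ⟨1, one_pos, by simp [hE]⟩
    · obtain ⟨z, hz, hmin⟩ := hKc.exists_isMinOn hne hcont
      refine ⟨‖G z - G xt‖, norm_pos_iff.2 (sub_ne_zero.2 fun he ↦ ?_), fun w hw ↦ hmin hw⟩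
      obtain ⟨i, rfl⟩ := (h.eq_iff z).1 he
      exact hz.2 (Set.mem_iUnion.2 ⟨i, Metric.mem_ball_self hr⟩)
  obtain ⟨c', hc', hmin⟩ := hK'
  refine ⟨min c c', lt_min hc hc', fun z hz ↦ ?_⟩
  rcases le_total R ‖z‖ with hz' | hz'
  · exact (min_le_left _ _).trans (hR z hz')
  · exact (min_le_right _ _).trans (hmin z ⟨by simpa using hz', hz⟩)

/-- With misfit bounded below by `c`, the integral is `O(exp (-c² N / 4))`, which beats the factor
`√N ^ d`. -/
lemma tendsto_setIntegral_compl (h : IsMultiwell G V₀ xt x) (η : EuclideanSpace ℝ (Fin d))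
    {r : ℝ} (hr : 0 < r) :
    Tendsto (fun N : ℕ ↦ √(N : ℝ) ^ d * ∫ z in (⋃ i, Metric.ball (x i) r)ᶜ,
      unnormalizedDensity G V₀ xt η N z) atTop (𝓝 0) := by
  obtain ⟨c, hc, hle⟩ := h.exists_le_norm_sub hr
  set I := ∫ z, Real.exp (-V₀ z) with hI
  have hlim : Tendsto (fun N : ℕ ↦ √(N : ℝ) ^ d *
      (Real.exp (‖η‖ ^ 2 / 2) * Real.exp (-(c ^ 2 / 4 * √(N : ℝ) ^ 2)) * I)) atTop (𝓝 0) := by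
    have hs : Tendsto (fun N : ℕ ↦ √(N : ℝ) ^ 2) atTop atTop :=
      (tendsto_pow_atTop two_ne_zero).comp
        (Real.tendsto_sqrt_atTop.comp tendsto_natCast_atTop_atTop)
    have h1 := (tendsto_rpow_mul_exp_neg_mul_atTop_nhds_zero ((d : ℝ) / 2) (c ^ 2 / 4)
      (by positivity)).comp hs
    have h2 := (h1.mul_const (Real.exp (‖η‖ ^ 2 / 2) * I))
    rw [zero_mul] at h2
    refine h2.congr fun N ↦ ?_
    have h3 : (√(N : ℝ) ^ 2) ^ ((d : ℝ) / 2) = √(N : ℝ) ^ d := by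
      rw [← Real.rpow_natCast _ 2, ← Real.rpow_mul (Real.sqrt_nonneg _)]
      rw [show ((2 : ℕ) : ℝ) * (d / 2) = d by push_cast; ring, Real.rpow_natCast]
    simp only [Function.comp]
    rw [h3, neg_mul]
    ring
  refine squeeze_zero' (Eventually.of_forall fun N ↦ ?_) ?_ hlim
  · exact mul_nonneg (by positivity)
      (setIntegral_nonneg_of_ae (ae_of_all _ fun z ↦ (unnormalizedDensity_pos N z).le))
  · filter_upwards [eventually_ge_atTop 1] with N hN
    gcongr
    rw [hI, ← integral_const_mul]
    have hmeas : MeasurableSet (⋃ i, Metric.ball (x i) r)ᶜ :=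
      (MeasurableSet.iUnion fun _ ↦ measurableSet_ball).compl
    refine (setIntegral_mono_on (h.integrable_unnormalizedDensity η N).integrableOn
      (h.integrable.const_mul _).integrableOn hmeas fun z hz ↦ ?_).trans
      (setIntegral_le_integral (h.integrable.const_mul _)
        (ae_of_all _ fun z ↦ by simp only [Pi.zero_apply]; positivity))
    have := unnormalizedDensity_le_of_le (V₀ := V₀) (η := η) hN (c := √(N : ℝ) * c)
      (by positivity) (mul_le_mul_of_nonneg_left (hle z hz) (Real.sqrt_nonneg _))
    refine this.trans_eq ?_
    rw [mul_pow]
    ring_nf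

end IsMultiwell

/-- The limiting mass of the rescaled unnormalised posterior near the solution `z`. -/
noncomputable def laplaceMass (G : EuclideanSpace ℝ (Fin d) → EuclideanSpace ℝ (Fin d))
    (V₀ : EuclideanSpace ℝ (Fin d) → ℝ) (z : EuclideanSpace ℝ (Fin d)) : ℝ :=
  (2 * Real.pi) ^ ((d : ℝ) / 2) * (|(jacobian G z).det|⁻¹ * Real.exp (-V₀ z))

lemma exp_eq_laplaceMass_mul {z : EuclideanSpace ℝ (Fin d)} (hz : (jacobian G z).det ≠ 0)
    (η y : EuclideanSpace ℝ (Fin d)) :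
    Real.exp (-(1 / 2 * ‖toEuclideanCLM (𝕜 := ℝ) (jacobian G z) y - η‖ ^ 2) - V₀ z) =
      laplaceMass G V₀ z * gaussianDensity (jacobian G z) η y := by
  have h1 : |(jacobian G z).det| ≠ 0 := by positivity
  have h2 : (2 * Real.pi) ^ ((d : ℝ) / 2) ≠ 0 := by positivity
  rw [laplaceMass, gaussianDensity, sub_eq_add_neg, Real.exp_add]
  field_simp

lemma limitWeight_eq (i : Fin n) :
    limitWeight G V₀ x i = (∑ j, laplaceMass G V₀ (x j))⁻¹ * laplaceMass G V₀ (x i) := by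
  have h2 : (2 * Real.pi) ^ ((d : ℝ) / 2) ≠ 0 := by positivity
  simp only [limitWeight, laplaceMass]
  rw [← Finset.mul_sum, mul_inv, mul_mul_mul_comm, inv_mul_cancel₀ h2, one_mul, div_eq_inv_mul]

-- Limiting masses and local limits of the posterior

namespace IsMultiwell

lemma laplaceMass_pos (h : IsMultiwell G V₀ xt x) (i : Fin n) : 0 < laplaceMass G V₀ (x i) := by
  have := h.det_ne_zero i
  unfold laplaceMass
  positivity

lemma nonempty (h : IsMultiwell G V₀ xt x) : Nonempty (Fin n) :=
  let ⟨i, _⟩ := (h.eq_iff xt).1 rfl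
  ⟨i⟩

lemma sum_laplaceMass_pos (h : IsMultiwell G V₀ xt x) : 0 < ∑ j, laplaceMass G V₀ (x j) :=
  have := h.nonempty
  Finset.sum_pos (fun i _ ↦ h.laplaceMass_pos i) Finset.univ_nonempty

lemma limitWeight_pos (h : IsMultiwell G V₀ xt x) (i : Fin n) : 0 < limitWeight G V₀ x i := by
  rw [limitWeight_eq]
  exact mul_pos (inv_pos.2 h.sum_laplaceMass_pos) (h.laplaceMass_pos i)

lemma sum_limitWeight (h : IsMultiwell G V₀ xt x) : ∑ i, limitWeight G V₀ x i = 1 := by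
  simp_rw [limitWeight_eq]
  rw [← Finset.mul_sum, inv_mul_cancel₀ h.sum_laplaceMass_pos.ne']

/-- Stated for all small radii, so that one radius can be chosen that also meets the disjointness
condition. -/
lemma eventually_local (h : IsMultiwell G V₀ xt x) :
    ∀ᶠ r in 𝓝[>] (0 : ℝ), ∀ i, ∃ κ > 0, ∀ v, ‖v‖ < r → κ * ‖v‖ ≤ ‖G (x i + v) - G (x i)‖ := by
  refine eventually_all.2 fun i ↦ ?_
  obtain ⟨κ, hκ, hr⟩ :=
    exists_mul_norm_le_norm_sub (h.det_ne_zero i) (hasFDerivAt_jacobian h.contDiff (x i))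
  exact hr.mono fun r hr ↦ ⟨κ, hκ, hr⟩

lemma eventually_disjoint (h : IsMultiwell G V₀ xt x) :
    ∀ᶠ r in 𝓝[>] (0 : ℝ), Pairwise (Function.onFun Disjoint fun i ↦ Metric.ball (x i) r) := by
  have : ∀ᶠ r in 𝓝[>] (0 : ℝ), ∀ i j, i ≠ j → r + r ≤ dist (x i) (x j) := by
    refine eventually_all.2 fun i ↦ eventually_all.2 fun j ↦ ?_
    by_cases hij : i = j
    · exact Eventually.of_forall fun _ hne ↦ absurd hij hne
    · have hd : 0 < dist (x i) (x j) := dist_pos.2 (h.injective.ne hij)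
      filter_upwards [Ioo_mem_nhdsGT (half_pos hd)] with r hr _
      linarith [hr.2]
  exact this.mono fun r hr i j hij ↦ Metric.ball_disjoint_ball (hr i j hij)

/-- Split the space into disjoint balls around the solutions and the rest: each ball contributes its
Laplace mass, the rest nothing. -/
lemma tendsto_normalizationConst (h : IsMultiwell G V₀ xt x) (η : EuclideanSpace ℝ (Fin d)) :
    Tendsto (fun N : ℕ ↦ √(N : ℝ) ^ d * normalizationConst G V₀ xt η N) atTop
      (𝓝 (∑ j, laplaceMass G V₀ (x j))) := by
  obtain ⟨r, ⟨hloc, hdisj⟩, hr⟩ :=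
    ((h.eventually_local.and h.eventually_disjoint).and self_mem_nhdsWithin).exists
  have hr0 : 0 < r := hr
  have hball : ∀ i, Tendsto (fun N : ℕ ↦ √(N : ℝ) ^ d * ∫ z in Metric.ball (x i) r,
      unnormalizedDensity G V₀ xt η N z) atTop (𝓝 (laplaceMass G V₀ (x i))) := by
    intro i
    obtain ⟨κ, hκ, hle⟩ := hloc i
    have h1 := h.tendsto_setIntegral_ball η i hr0 hκ hle (ψ := fun _ ↦ 1) measurable_const (by simp)
    simp_rw [exp_eq_laplaceMass_mul (V₀ := V₀) (h.det_ne_zero i) η] at h1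
    have h2 := (Complex.continuous_re.tendsto _).comp h1
    simp only [Complex.real_smul, mul_one, integral_complex_ofReal, Complex.ofReal_re,
      integral_const_mul, integral_gaussianDensity (h.det_ne_zero i)] at h2
    refine h2.congr fun N ↦ ?_
    simp only [Function.comp]
    rw [← Complex.ofReal_mul, Complex.ofReal_re]
  have hsum := (tendsto_finsetSum Finset.univ fun i _ ↦ hball i).add
    (h.tendsto_setIntegral_compl η hr0)
  rw [add_zero] at hsum
  refine hsum.congr fun N ↦ ?_
  have hint := h.integrable_unnormalizedDensity η N
  rw [← Finset.mul_sum, ← mul_add, ← integral_iUnion_fintype (fun _ ↦ measurableSet_ball) hdisj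
    (fun _ ↦ hint.integrableOn), integral_add_compl
    (MeasurableSet.iUnion fun _ ↦ measurableSet_ball) hint, normalizationConst]

/-- The posterior, rescaled near a solution, converges to a multiple of a Gaussian measure. -/
lemma tendsto_setIntegral_posterior (h : IsMultiwell G V₀ xt x) (η : EuclideanSpace ℝ (Fin d))
    (i : Fin n) {r : ℝ} (hr : 0 < r)
    (hloc : ∃ κ > 0, ∀ v, ‖v‖ < r → κ * ‖v‖ ≤ ‖G (x i + v) - G (x i)‖)
    {ψ : EuclideanSpace ℝ (Fin d) → ℂ} (hψ : Measurable ψ) (hψ1 : ∀ y, ‖ψ y‖ ≤ 1) :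
    Tendsto (fun N : ℕ ↦ ∫ z in Metric.ball (x i) r, ψ (√(N : ℝ) • (z - x i))
        ∂smallNoisePosterior G V₀ xt η N) atTop
      (𝓝 (limitWeight G V₀ x i • ∫ y, gaussianDensity (jacobian G (x i)) η y • ψ y)) := by
  obtain ⟨κ, hκ, hle⟩ := hloc
  have h1 := h.tendsto_setIntegral_ball η i hr hκ hle hψ hψ1
  simp_rw [exp_eq_laplaceMass_mul (V₀ := V₀) (h.det_ne_zero i) η, mul_smul] at h1
  rw [integral_smul] at h1
  have h2 := ((h.tendsto_normalizationConst η).inv₀ h.sum_laplaceMass_pos.ne').smul h1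
  rw [smul_smul, ← limitWeight_eq] at h2
  refine h2.congr' ?_
  filter_upwards [eventually_ge_atTop 1] with N hN
  have hs : √(N : ℝ) ^ d ≠ 0 := (pow_pos (Real.sqrt_pos.2 (by exact_mod_cast hN)) d).ne'
  rw [h.setIntegral_posterior η N measurableSet_ball, smul_smul, mul_inv, mul_comm, ← mul_assoc,
    mul_inv_cancel₀ hs, one_mul]

lemma tendsto_setIntegral_cexp_posterior (h : IsMultiwell G V₀ xt x)
    (η : EuclideanSpace ℝ (Fin d)) (i : Fin n) {r : ℝ} (hr : 0 < r)
    (hloc : ∃ κ > 0, ∀ v, ‖v‖ < r → κ * ‖v‖ ≤ ‖G (x i + v) - G (x i)‖)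
    (t : EuclideanSpace ℝ (Fin d)) :
    Tendsto (fun N : ℕ ↦ ∫ z in Metric.ball (x i) r,
        Complex.exp (inner ℝ (√(N : ℝ) • (z - x i)) t * Complex.I)
        ∂smallNoisePosterior G V₀ xt η N) atTop
      (𝓝 (limitWeight G V₀ x i • charFun (multivariateGaussian
        (toEuclideanCLM (𝕜 := ℝ) (jacobian G (x i))⁻¹ η) (limitCov G (x i))) t)) := by
  have h1 := h.tendsto_setIntegral_posterior η i hr hloc
    (ψ := fun y ↦ Complex.exp (inner ℝ y t * Complex.I)) (by fun_prop)
    (fun y ↦ (Complex.norm_exp_ofReal_mul_I _).le)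
  convert h1 using 3
  rw [limitCov, multivariateGaussian_inv_gram (h.det_ne_zero i),
    toEuclideanCLM_apply_inv (h.det_ne_zero i), charFun_apply,
    integral_withDensity_eq_integral_toReal_smul
      (continuous_gaussianDensity _ _).measurable.ennreal_ofReal (by simp)]
  simp_rw [ENNReal.toReal_ofReal (gaussianDensity_pos (h.det_ne_zero i) η _).le]

lemma tendsto_posterior_real_ball (h : IsMultiwell G V₀ xt x) (η : EuclideanSpace ℝ (Fin d))
    (i : Fin n) {r : ℝ} (hr : 0 < r)
    (hloc : ∃ κ > 0, ∀ v, ‖v‖ < r → κ * ‖v‖ ≤ ‖G (x i + v) - G (x i)‖) :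
    Tendsto (fun N : ℕ ↦ (smallNoisePosterior G V₀ xt η N).real (Metric.ball (x i) r)) atTop
      (𝓝 (limitWeight G V₀ x i)) := by
  have h1 := h.tendsto_setIntegral_posterior η i hr hloc (ψ := fun _ ↦ 1) measurable_const (by simp)
  have h2 := (Complex.continuous_re.tendsto _).comp h1
  simp only [Complex.real_smul, mul_one, integral_complex_ofReal, Complex.ofReal_re,
    integral_gaussianDensity (h.det_ne_zero i), Complex.ofReal_one] at h2
  refine h2.congr fun N ↦ ?_
  simp

end IsMultiwell

-- Growth bounds and the competitor mixture

lemma norm_sq_le_inv_mul_exp {F : Type*} [NormedAddCommGroup F] {ε : ℝ} (hε : 0 < ε) (y : F) :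
    ‖y‖ ^ 2 ≤ ε⁻¹ * Real.exp (ε * ‖y‖ ^ 2) := by
  rw [le_inv_mul_iff₀ hε]
  linarith [Real.add_one_le_exp (ε * ‖y‖ ^ 2)]

lemma one_le_exp_mul_norm_sq {F : Type*} [NormedAddCommGroup F] {ε : ℝ} (hε : 0 < ε) (y : F) :
    1 ≤ Real.exp (ε * ‖y‖ ^ 2) := Real.one_le_exp (by positivity)

/-- Rescaling tames the growth hypothesis: the `y`-part of `exp ‖·‖²` acquires the factor `2/s² ≤
ε`, and with `s = √N` any `ε > 0` is reached for large `N`. -/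
lemma exp_norm_add_sq_le {ε s : ℝ} (hs : 0 < s) (hε : 2 ≤ ε * s ^ 2)
    (z y : EuclideanSpace ℝ (Fin d)) :
    Real.exp (‖z + s⁻¹ • y‖ ^ 2) ≤ Real.exp (2 * ‖z‖ ^ 2) * Real.exp (ε * ‖y‖ ^ 2) := by
  rw [← Real.exp_add, Real.exp_le_exp]
  refine (norm_add_sq_le _ _).trans ?_
  rw [norm_smul, norm_inv, Real.norm_of_nonneg hs.le, mul_pow, inv_pow]
  have h1 : 2 * (s ^ 2)⁻¹ ≤ ε := by
    rw [← div_eq_mul_inv, div_le_iff₀ (by positivity)]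
    exact hε
  have h2 : 2 * (s ^ 2)⁻¹ * ‖y‖ ^ 2 ≤ ε * ‖y‖ ^ 2 := by gcongr
  linarith

lemma eventually_two_le_mul_sqrt_sq {ε : ℝ} (hε : 0 < ε) :
    ∀ᶠ N : ℕ in atTop, 0 < √(N : ℝ) ∧ 2 ≤ ε * √(N : ℝ) ^ 2 := by
  filter_upwards [eventually_ge_atTop 1,
    (tendsto_natCast_atTop_atTop (R := ℝ)).eventually_ge_atTop (2 / ε)] with N hN hN'
  refine ⟨Real.sqrt_pos.2 (by exact_mod_cast hN), ?_⟩
  rw [Real.sq_sqrt (by positivity), ← div_le_iff₀' hε]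
  exact hN'

/-- Where `‖y‖ < r √N`, differentiability gives a bound quadratic in `y`. Elsewhere `√N ≤ ‖y‖ / r`,
so the prefactor `N` is itself controlled by `‖y‖²` and the growth hypothesis handles `G`. -/
lemma exists_misfit_le (hG : ContDiff ℝ 1 G) {M : ℝ}
    (hM : ∀ z, ‖G z‖ ^ 2 ≤ M * Real.exp (‖z‖ ^ 2)) (z η : EuclideanSpace ℝ (Fin d)) {ε : ℝ}
    (hε : 0 < ε) :
    ∃ K, ∀ᶠ N : ℕ in atTop, ∀ y,
      1 / 2 * ‖√(N : ℝ) • (G z - G (z + (√(N : ℝ))⁻¹ • y)) + η‖ ^ 2 ≤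
        K * Real.exp (ε * ‖y‖ ^ 2) := by
  obtain ⟨r, hr, L, hL, hloc⟩ := exists_norm_sub_le_mul_norm (hasFDerivAt_jacobian hG z)
  have hM0 : 0 ≤ M := by
    have := (sq_nonneg _).trans (hM 0)
    exact nonneg_of_mul_nonneg_left this (Real.exp_pos _)
  set A := 2 * ‖G z‖ ^ 2 + 2 * (M * Real.exp (2 * ‖z‖ ^ 2)) with hA
  have hA0 : 0 ≤ A := by positivity
  refine ⟨L ^ 2 * ε⁻¹ + (r ^ 2)⁻¹ * (ε / 2)⁻¹ * A + ‖η‖ ^ 2, ?_⟩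
  -- Only `ε / 2` is spent on the growth of `G`; the other half pays for the factor `s²` far from
  -- the centre.
  filter_upwards [eventually_two_le_mul_sqrt_sq (half_pos hε)] with N hN y
  obtain ⟨hs, hN⟩ := hN
  set s := √(N : ℝ)
  set D := G z - G (z + s⁻¹ • y) with hD
  have h1 := one_le_exp_mul_norm_sq hε y
  have hsD : ‖s • D‖ ^ 2 ≤
      (L ^ 2 * ε⁻¹ + (r ^ 2)⁻¹ * (ε / 2)⁻¹ * A) * Real.exp (ε * ‖y‖ ^ 2) := by
    have hny : ‖s⁻¹ • y‖ = s⁻¹ * ‖y‖ := by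
      rw [norm_smul, norm_inv, Real.norm_of_nonneg hs.le]
    rw [norm_smul, Real.norm_of_nonneg hs.le]
    by_cases hy : ‖s⁻¹ • y‖ < r
    · have h2 := hloc _ hy
      rw [norm_sub_rev, ← hD, hny] at h2
      have h3 : s * ‖D‖ ≤ L * ‖y‖ := by
        calc s * ‖D‖ ≤ s * (L * (s⁻¹ * ‖y‖)) := by gcongr
          _ = L * ‖y‖ := by field_simp
      calc (s * ‖D‖) ^ 2 ≤ (L * ‖y‖) ^ 2 := by gcongr
        _ = L ^ 2 * ‖y‖ ^ 2 := by ring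
        _ ≤ L ^ 2 * (ε⁻¹ * Real.exp (ε * ‖y‖ ^ 2)) := by
          gcongr
          exact norm_sq_le_inv_mul_exp hε y
        _ ≤ L ^ 2 * (ε⁻¹ * Real.exp (ε * ‖y‖ ^ 2)) +
            (r ^ 2)⁻¹ * (ε / 2)⁻¹ * A * Real.exp (ε * ‖y‖ ^ 2) :=
          le_add_of_nonneg_right (by positivity)
        _ = _ := by ring
    · rw [not_lt, hny, le_inv_mul_iff₀ hs] at hy
      have h2 : s ^ 2 ≤ (r ^ 2)⁻¹ * ‖y‖ ^ 2 := by
        rw [le_inv_mul_iff₀ (by positivity), mul_comm, ← mul_pow]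
        gcongr
      have h3 : ‖D‖ ^ 2 ≤ A * Real.exp (ε / 2 * ‖y‖ ^ 2) := by
        have h4 := norm_add_sq_le (G z) (-G (z + s⁻¹ • y))
        rw [← sub_eq_add_neg, ← hD, norm_neg] at h4
        have h5 := (hM (z + s⁻¹ • y)).trans
          (mul_le_mul_of_nonneg_left (exp_norm_add_sq_le hs hN z y) hM0)
        have h6 : ‖G z‖ ^ 2 ≤ ‖G z‖ ^ 2 * Real.exp (ε / 2 * ‖y‖ ^ 2) :=
          le_mul_of_one_le_right (by positivity) (one_le_exp_mul_norm_sq (half_pos hε) y)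
        rw [hA]
        linarith
      have h4 : Real.exp (ε * ‖y‖ ^ 2) =
          Real.exp (ε / 2 * ‖y‖ ^ 2) * Real.exp (ε / 2 * ‖y‖ ^ 2) := by
        rw [← Real.exp_add]
        ring_nf
      calc (s * ‖D‖) ^ 2 = s ^ 2 * ‖D‖ ^ 2 := by ring
        _ ≤ ((r ^ 2)⁻¹ * ((ε / 2)⁻¹ * Real.exp (ε / 2 * ‖y‖ ^ 2))) *
            (A * Real.exp (ε / 2 * ‖y‖ ^ 2)) := by
          gcongr
          refine h2.trans ?_
          gcongr
          exact norm_sq_le_inv_mul_exp (half_pos hε) y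
        _ = (r ^ 2)⁻¹ * (ε / 2)⁻¹ * A * Real.exp (ε * ‖y‖ ^ 2) := by
          rw [h4]
          ring
        _ ≤ L ^ 2 * ε⁻¹ * Real.exp (ε * ‖y‖ ^ 2) +
            (r ^ 2)⁻¹ * (ε / 2)⁻¹ * A * Real.exp (ε * ‖y‖ ^ 2) :=
          le_add_of_nonneg_left (by positivity)
        _ = _ := by ring
  have h2 := norm_add_sq_le (s • D) η
  have h3 : ‖η‖ ^ 2 ≤ ‖η‖ ^ 2 * Real.exp (ε * ‖y‖ ^ 2) := le_mul_of_one_le_right (by positivity) h1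
  linarith

lemma gaussianDensity_le (J : Matrix (Fin d) (Fin d) ℝ) (w y : EuclideanSpace ℝ (Fin d)) :
    gaussianDensity J w y ≤ |J.det| * ((2 * Real.pi) ^ ((d : ℝ) / 2))⁻¹ := by
  unfold gaussianDensity
  refine mul_le_of_le_one_right (by positivity) (Real.exp_le_one_iff.2 (neg_nonpos.2 ?_))
  positivity

/-- The decay rate is written `2ε` so that `exp (-ε‖y‖²)` is left after multiplication by a function
of growth `exp (ε‖y‖²)`. -/
lemma exists_gaussianDensity_le {J : Matrix (Fin d) (Fin d) ℝ} (hJ : J.det ≠ 0)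
    (w : EuclideanSpace ℝ (Fin d)) :
    ∃ ε > 0, ∃ C, 0 ≤ C ∧ ∀ y, gaussianDensity J w y ≤ C * Real.exp (-(2 * ε * ‖y‖ ^ 2)) := by
  obtain ⟨κ, hκ, hle⟩ := exists_le_norm_toEuclideanCLM hJ
  refine ⟨κ ^ 2 / 8, by positivity,
    |J.det| * ((2 * Real.pi) ^ ((d : ℝ) / 2))⁻¹ * Real.exp (‖w‖ ^ 2 / 2), by positivity,
    fun y ↦ ?_⟩
  unfold gaussianDensity
  rw [mul_assoc _ (Real.exp _), ← Real.exp_add]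
  gcongr
  have h1 := half_norm_sq_sub_le (toEuclideanCLM (𝕜 := ℝ) J y) (-w)
  rw [← sub_eq_add_neg, norm_neg] at h1
  have h2 : (κ * ‖y‖) ^ 2 ≤ ‖toEuclideanCLM (𝕜 := ℝ) J y‖ ^ 2 := by
    gcongr
    exact hle y
  rw [mul_pow] at h2
  linarith

lemma tendsto_gaussianDensity_add_smul {J : Matrix (Fin d) (Fin d) ℝ} (hJ : J.det ≠ 0)
    (w y : EuclideanSpace ℝ (Fin d)) {v : EuclideanSpace ℝ (Fin d)} (hv : v ≠ 0) :
    Tendsto (fun N : ℕ ↦ gaussianDensity J w (y + √(N : ℝ) • v)) atTop (𝓝 0) := by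
  obtain ⟨ε, hε, C, hC, hle⟩ := exists_gaussianDensity_le hJ w
  have h1 : Tendsto (fun N : ℕ ↦ ‖y + √(N : ℝ) • v‖) atTop atTop := by
    have hs : Tendsto (fun N : ℕ ↦ √(N : ℝ)) atTop atTop :=
      Real.tendsto_sqrt_atTop.comp tendsto_natCast_atTop_atTop
    refine tendsto_atTop_mono (fun N ↦ ?_)
      (tendsto_atTop_add_const_right _ (-‖y‖) (hs.atTop_mul_const (norm_pos_iff.2 hv)))
    have h2 := norm_sub_le (y + √(N : ℝ) • v) y
    rw [add_sub_cancel_left, norm_smul, Real.norm_of_nonneg (Real.sqrt_nonneg _)] at h2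
    linarith
  have h2 : Tendsto (fun N : ℕ ↦ C * Real.exp (-(2 * ε * ‖y + √(N : ℝ) • v‖ ^ 2))) atTop
      (𝓝 0) := by
    have h3 := Real.tendsto_exp_neg_atTop_nhds_zero.comp
      (((tendsto_pow_atTop two_ne_zero).comp h1).const_mul_atTop (by positivity : 0 < 2 * ε))
    simpa using h3.const_mul C
  exact squeeze_zero (fun N ↦ (gaussianDensity_pos hJ w _).le) (fun N ↦ hle _) h2

/-- The density of the Gaussian mixture which is used as a competitor. -/
noncomputable def competitorDensity (G : EuclideanSpace ℝ (Fin d) → EuclideanSpace ℝ (Fin d))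
    (V₀ : EuclideanSpace ℝ (Fin d) → ℝ) (η : EuclideanSpace ℝ (Fin d))
    (x : Fin n → EuclideanSpace ℝ (Fin d)) (N : ℕ) (z : EuclideanSpace ℝ (Fin d)) : ℝ :=
  ∑ j, limitWeight G V₀ x j *
    (√(N : ℝ) ^ d * gaussianDensity (jacobian G (x j)) η (√(N : ℝ) • (z - x j)))

/-- The means of the competitor. -/
noncomputable def competitorMean (G : EuclideanSpace ℝ (Fin d) → EuclideanSpace ℝ (Fin d))
    (η : EuclideanSpace ℝ (Fin d)) (x : Fin n → EuclideanSpace ℝ (Fin d)) (N : ℕ) (j : Fin n) :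
    EuclideanSpace ℝ (Fin d) :=
  x j + (√(N : ℝ))⁻¹ • toEuclideanCLM (𝕜 := ℝ) (jacobian G (x j))⁻¹ η

/-- The unscaled density formula is applied to `√N • J`, whose determinant supplies the factor `√N ^
d`. -/
lemma multivariateGaussian_rescaled {J : Matrix (Fin d) (Fin d) ℝ} (hJ : J.det ≠ 0) {N : ℕ}
    (hN : 1 ≤ N) (z η : EuclideanSpace ℝ (Fin d)) :
    multivariateGaussian (z + (√(N : ℝ))⁻¹ • toEuclideanCLM (𝕜 := ℝ) J⁻¹ η)
      ((1 / (N : ℝ)) • (Jᵀ * J)⁻¹) = volume.withDensity fun y ↦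
        ENNReal.ofReal (√(N : ℝ) ^ d * gaussianDensity J η (√(N : ℝ) • (y - z))) := by
  have hN0 : (0 : ℝ) < N := by exact_mod_cast hN
  have hs : 0 < √(N : ℝ) := Real.sqrt_pos.2 hN0
  have hdet : (√(N : ℝ) • J).det = √(N : ℝ) ^ d * J.det := by
    rw [det_smul, Fintype.card_fin]
  have hJ' : (√(N : ℝ) • J).det ≠ 0 := by
    rw [hdet]
    positivity
  have hcov : (1 / (N : ℝ)) • (Jᵀ * J)⁻¹ = ((√(N : ℝ) • J)ᵀ * (√(N : ℝ) • J))⁻¹ := by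
    have hu : IsUnit (Jᵀ * J).det := by
      rw [det_mul, det_transpose]
      exact isUnit_iff_ne_zero.2 (mul_ne_zero hJ hJ)
    rw [transpose_smul, Matrix.smul_mul, Matrix.mul_smul, smul_smul, Real.mul_self_sqrt hN0.le]
    have := Matrix.inv_smul' (Jᵀ * J) (Units.mk0 (N : ℝ) hN0.ne') hu
    rw [Units.smul_mk0] at this
    rw [this, one_div]
    rfl
  rw [hcov, multivariateGaussian_inv_gram hJ']
  congr 1
  ext y
  congr 1
  have harg : toEuclideanCLM (𝕜 := ℝ) (√(N : ℝ) • J) y - toEuclideanCLM (𝕜 := ℝ) (√(N : ℝ) • J)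
      (z + (√(N : ℝ))⁻¹ • toEuclideanCLM (𝕜 := ℝ) J⁻¹ η) =
      toEuclideanCLM (𝕜 := ℝ) J (√(N : ℝ) • (y - z)) - η := by
    simp only [map_smul, map_add, map_sub, _root_.smul_apply, smul_sub]
    rw [toEuclideanCLM_apply_inv hJ, smul_smul, inv_mul_cancel₀ hs.ne', one_smul]
    abel
  rw [gaussianDensity, harg, hdet, abs_mul, abs_of_pos (pow_pos hs d), gaussianDensity]
  ring

namespace IsMultiwell

lemma mixture_competitor (h : IsMultiwell G V₀ xt x) (η : EuclideanSpace ℝ (Fin d)) {N : ℕ}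
    (hN : 1 ≤ N) :
    mixture (limitWeight G V₀ x) (competitorMean G η x N)
      (fun j ↦ (1 / (N : ℝ)) • limitCov G (x j)) =
      volume.withDensity fun z ↦ ENNReal.ofReal (competitorDensity G V₀ η x N z) := by
  have hpos : ∀ j z, 0 ≤ √(N : ℝ) ^ d *
      gaussianDensity (jacobian G (x j)) η (√(N : ℝ) • (z - x j)) := fun j z ↦
    mul_nonneg (by positivity) (gaussianDensity_pos (h.det_ne_zero j) _ _).le
  ext A hA
  rw [mixture, withDensity_apply _ hA, Measure.finsetSum_apply]
  simp_rw [competitorDensity, ENNReal.ofReal_sum_of_nonneg fun j _ ↦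
    mul_nonneg (h.limitWeight_pos j).le (hpos j _), ENNReal.ofReal_mul (h.limitWeight_pos _).le]
  have hm : ∀ j, Measurable fun z ↦ ENNReal.ofReal (√(N : ℝ) ^ d *
      gaussianDensity (jacobian G (x j)) η (√(N : ℝ) • (z - x j))) := fun j ↦ by
    have := (continuous_gaussianDensity (jacobian G (x j)) η).measurable
    fun_prop
  rw [lintegral_finsetSum _ fun j _ ↦ (hm j).const_mul _]
  refine Finset.sum_congr rfl fun j _ ↦ ?_
  rw [lintegral_const_mul _ (hm j), competitorMean, limitCov,
    multivariateGaussian_rescaled (h.det_ne_zero j) hN, Measure.smul_apply,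
    withDensity_apply _ hA, smul_eq_mul]

end IsMultiwell

lemma integrable_iff_comp_add_smul {F : Type*} [NormedAddCommGroup F] {s : ℝ} (hs : 0 < s)
    (x₀ : EuclideanSpace ℝ (Fin d)) (f : EuclideanSpace ℝ (Fin d) → F) :
    Integrable (fun y ↦ f (x₀ + s⁻¹ • y)) ↔ Integrable f := by
  rw [integrable_comp_smul_iff volume (fun z ↦ f (x₀ + z)) (inv_ne_zero hs.ne')]
  exact ⟨fun h ↦ by simpa using h.comp_add_left (-x₀), fun h ↦ h.comp_add_left x₀⟩

/-- The competitor's density near the solution `xⱼ`, after rescaling. -/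
noncomputable def rescaledCompetitor (G : EuclideanSpace ℝ (Fin d) → EuclideanSpace ℝ (Fin d))
    (V₀ : EuclideanSpace ℝ (Fin d) → ℝ) (η : EuclideanSpace ℝ (Fin d))
    (x : Fin n → EuclideanSpace ℝ (Fin d)) (j : Fin n) (N : ℕ) (y : EuclideanSpace ℝ (Fin d)) : ℝ :=
  ∑ k, limitWeight G V₀ x k *
    gaussianDensity (jacobian G (x k)) η (y + √(N : ℝ) • (x j - x k))

/-- The logarithm of the ratio of the densities of the competitor and of the posterior. -/
noncomputable def logRatio (G : EuclideanSpace ℝ (Fin d) → EuclideanSpace ℝ (Fin d))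
    (V₀ : EuclideanSpace ℝ (Fin d) → ℝ) (xt η : EuclideanSpace ℝ (Fin d))
    (x : Fin n → EuclideanSpace ℝ (Fin d)) (N : ℕ) (z : EuclideanSpace ℝ (Fin d)) : ℝ :=
  Real.log (competitorDensity G V₀ η x N z /
    ((normalizationConst G V₀ xt η N)⁻¹ * unnormalizedDensity G V₀ xt η N z))

lemma competitorDensity_add_smul {N : ℕ} (hN : 1 ≤ N) (j : Fin n)
    (y : EuclideanSpace ℝ (Fin d)) :
    competitorDensity G V₀ η x N (x j + (√(N : ℝ))⁻¹ • y) =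
      √(N : ℝ) ^ d * rescaledCompetitor G V₀ η x j N y := by
  have hs : 0 < √(N : ℝ) := Real.sqrt_pos.2 (by exact_mod_cast hN)
  rw [competitorDensity, rescaledCompetitor, Finset.mul_sum]
  refine Finset.sum_congr rfl fun k _ ↦ ?_
  have : √(N : ℝ) • (x j + (√(N : ℝ))⁻¹ • y - x k) = y + √(N : ℝ) • (x j - x k) := by
    rw [add_sub_right_comm, smul_add, smul_smul, mul_inv_cancel₀ hs.ne', one_smul, add_comm]
  rw [this]
  ring

lemma continuous_competitorDensity (N : ℕ) : Continuous (competitorDensity G V₀ η x N) := by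
  unfold competitorDensity
  refine continuous_finsetSum _ fun j _ ↦ ?_
  have := continuous_gaussianDensity (jacobian G (x j)) η
  fun_prop

-- The log-ratio of competitor and posterior

namespace IsMultiwell

lemma rescaledCompetitor_pos (h : IsMultiwell G V₀ xt x) (η : EuclideanSpace ℝ (Fin d))
    (j : Fin n) (N : ℕ) (y : EuclideanSpace ℝ (Fin d)) :
    0 < rescaledCompetitor G V₀ η x j N y :=
  have := h.nonempty
  Finset.sum_pos (fun k _ ↦ mul_pos (h.limitWeight_pos k)
    (gaussianDensity_pos (h.det_ne_zero k) _ _)) Finset.univ_nonempty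

lemma competitorDensity_pos (h : IsMultiwell G V₀ xt x) (η : EuclideanSpace ℝ (Fin d))
    {N : ℕ} (hN : 1 ≤ N) (z : EuclideanSpace ℝ (Fin d)) :
    0 < competitorDensity G V₀ η x N z := by
  have := h.nonempty
  have hs : 0 < √(N : ℝ) := Real.sqrt_pos.2 (by exact_mod_cast hN)
  exact Finset.sum_pos (fun k _ ↦ mul_pos (h.limitWeight_pos k) (mul_pos (pow_pos hs d)
    (gaussianDensity_pos (h.det_ne_zero k) _ _))) Finset.univ_nonempty

/-- The factor `√N ^ d` of the competitor joins the normalisation constant, so that every summand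
has a limit. -/
lemma logRatio_add_smul (h : IsMultiwell G V₀ xt x) (η : EuclideanSpace ℝ (Fin d)) {N : ℕ}
    (hN : 1 ≤ N) (j : Fin n) (y : EuclideanSpace ℝ (Fin d)) :
    logRatio G V₀ xt η x N (x j + (√(N : ℝ))⁻¹ • y) =
      Real.log (rescaledCompetitor G V₀ η x j N y) +
      Real.log (√(N : ℝ) ^ d * normalizationConst G V₀ xt η N) +
      1 / 2 * ‖√(N : ℝ) • (G (x j) - G (x j + (√(N : ℝ))⁻¹ • y)) + η‖ ^ 2 +
      V₀ (x j + (√(N : ℝ))⁻¹ • y) := by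
  have hs : 0 < √(N : ℝ) := Real.sqrt_pos.2 (by exact_mod_cast hN)
  have hZ := h.normalizationConst_pos η N
  have hP := h.rescaledCompetitor_pos η j N y
  have hu := unnormalizedDensity_pos (G := G) (V₀ := V₀) (xt := xt) (η := η) N
    (x j + (√(N : ℝ))⁻¹ • y)
  have hlog := congrArg Real.log (unnormalizedDensity_eq (G := G) (V₀ := V₀) (xt := xt) (η := η) hN
    (x j + (√(N : ℝ))⁻¹ • y))
  rw [Real.log_exp] at hlog
  rw [logRatio, competitorDensity_add_smul hN,
    Real.log_div (mul_pos (pow_pos hs d) hP).ne' (mul_pos (inv_pos.2 hZ) hu).ne',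
    Real.log_mul (pow_pos hs d).ne' hP.ne', Real.log_mul (inv_pos.2 hZ).ne' hu.ne', hlog,
    Real.log_mul (pow_pos hs d).ne' hZ.ne', Real.log_inv, h.apply_eq j]
  ring

/-- Seen from `xⱼ` at scale `1/√N`, the other components escape to infinity and only the `j`-th
survives. -/
lemma tendsto_rescaledCompetitor (h : IsMultiwell G V₀ xt x) (η : EuclideanSpace ℝ (Fin d))
    (j : Fin n) (y : EuclideanSpace ℝ (Fin d)) :
    Tendsto (fun N : ℕ ↦ rescaledCompetitor G V₀ η x j N y) atTop
      (𝓝 (limitWeight G V₀ x j * gaussianDensity (jacobian G (x j)) η y)) := by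
  have h1 : ∀ k, Tendsto (fun N : ℕ ↦ limitWeight G V₀ x k *
      gaussianDensity (jacobian G (x k)) η (y + √(N : ℝ) • (x j - x k))) atTop
      (𝓝 (if k = j then limitWeight G V₀ x j * gaussianDensity (jacobian G (x j)) η y else 0)) := by
    intro k
    split_ifs with hk
    · subst hk
      simp
    · simpa using (tendsto_gaussianDensity_add_smul (h.det_ne_zero k) η y
        (sub_ne_zero.2 (h.injective.ne (Ne.symm hk)))).const_mul (limitWeight G V₀ x k)
  simpa [rescaledCompetitor] using tendsto_finsetSum Finset.univ fun k _ ↦ h1 k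

lemma tendsto_logRatio (h : IsMultiwell G V₀ xt x) (η : EuclideanSpace ℝ (Fin d)) (j : Fin n)
    (y : EuclideanSpace ℝ (Fin d)) :
    Tendsto (fun N : ℕ ↦ logRatio G V₀ xt η x N (x j + (√(N : ℝ))⁻¹ • y)) atTop (𝓝 0) := by
  have hgd := gaussianDensity_pos (h.det_ne_zero j) η y
  have hβ := h.limitWeight_pos j
  have hS := h.sum_laplaceMass_pos
  have h1 := (h.tendsto_rescaledCompetitor η j y).log (mul_pos hβ hgd).ne'
  have h2 := (h.tendsto_normalizationConst η).log hS.ne'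
  have h3 := (((tendsto_smul_sub (hasFDerivAt_jacobian h.contDiff (x j)) y).add_const η).norm.pow
    2).const_mul (1 / 2)
  have h4 := (h.continuous.tendsto _).comp (tendsto_add_inv_sqrt_smul (x j) y)
  have h5 := ((h1.add h2).add h3).add h4
  -- The four limits cancel because the competitor's weights and Gaussians are exactly the Laplace
  -- limits of the posterior.
  have hlim : Real.log (limitWeight G V₀ x j * gaussianDensity (jacobian G (x j)) η y) +
      Real.log (∑ k, laplaceMass G V₀ (x k)) +
      1 / 2 * ‖-toEuclideanCLM (𝕜 := ℝ) (jacobian G (x j)) y + η‖ ^ 2 + V₀ (x j) = 0 := by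
    have h6 := congrArg Real.log (exp_eq_laplaceMass_mul (V₀ := V₀) (h.det_ne_zero j) η y)
    rw [Real.log_exp] at h6
    rw [limitWeight_eq, mul_assoc, Real.log_mul (inv_pos.2 hS).ne'
      (mul_pos (h.laplaceMass_pos j) hgd).ne', ← h6, Real.log_inv,
      neg_add_eq_sub (toEuclideanCLM (𝕜 := ℝ) (jacobian G (x j)) y) η, norm_sub_rev η]
    ring
  rw [hlim] at h5
  refine h5.congr' ?_
  filter_upwards [eventually_ge_atTop 1] with N hN
  rw [h.logRatio_add_smul η hN]
  rfl

/-- Above, every Gaussian density is bounded by its peak. Below, it suffices to keep the `j`-th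
term, which does not depend on `N` and has a logarithm quadratic in `y`. -/
lemma exists_abs_log_rescaledCompetitor_le (h : IsMultiwell G V₀ xt x)
    (η : EuclideanSpace ℝ (Fin d)) (j : Fin n) {ε : ℝ} (hε : 0 < ε) :
    ∃ K, ∀ N y, |Real.log (rescaledCompetitor G V₀ η x j N y)| ≤
      K * Real.exp (ε * ‖y‖ ^ 2) := by
  set B := ∑ k, limitWeight G V₀ x k *
    (|(jacobian G (x k)).det| * ((2 * Real.pi) ^ ((d : ℝ) / 2))⁻¹) with hB
  set c := limitWeight G V₀ x j *
    (|(jacobian G (x j)).det| * ((2 * Real.pi) ^ ((d : ℝ) / 2))⁻¹) with hc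
  have hc0 : 0 < c := by
    have := h.limitWeight_pos j
    have := h.det_ne_zero j
    positivity
  set T := ‖toEuclideanCLM (𝕜 := ℝ) (jacobian G (x j))‖
  refine ⟨|Real.log B| + |Real.log c| + T ^ 2 * ε⁻¹ + ‖η‖ ^ 2, fun N y ↦ ?_⟩
  have hP := h.rescaledCompetitor_pos η j N y
  have hup : Real.log (rescaledCompetitor G V₀ η x j N y) ≤ |Real.log B| := by
    refine (Real.log_le_log hP (Finset.sum_le_sum fun k _ ↦ ?_)).trans (le_abs_self _)
    exact mul_le_mul_of_nonneg_left (gaussianDensity_le _ _ _) (h.limitWeight_pos k).le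
  have hlow : c * Real.exp (-(1 / 2 * ‖toEuclideanCLM (𝕜 := ℝ) (jacobian G (x j)) y - η‖ ^ 2)) ≤
      rescaledCompetitor G V₀ η x j N y := by
    have h1 := Finset.single_le_sum (f := fun k ↦ limitWeight G V₀ x k *
      gaussianDensity (jacobian G (x k)) η (y + √(N : ℝ) • (x j - x k)))
      (fun k _ ↦ (mul_pos (h.limitWeight_pos k) (gaussianDensity_pos (h.det_ne_zero k) _ _)).le)
      (Finset.mem_univ j)
    simp only [sub_self, smul_zero, add_zero] at h1
    refine le_trans (le_of_eq ?_) h1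
    rw [gaussianDensity, hc]
    ring
  have hlow' := Real.log_le_log (mul_pos hc0 (Real.exp_pos _)) hlow
  rw [Real.log_mul hc0.ne' (Real.exp_pos _).ne', Real.log_exp] at hlow'
  have h2 := norm_add_sq_le (toEuclideanCLM (𝕜 := ℝ) (jacobian G (x j)) y) (-η)
  rw [← sub_eq_add_neg, norm_neg] at h2
  have h3 : ‖toEuclideanCLM (𝕜 := ℝ) (jacobian G (x j)) y‖ ^ 2 ≤
      T ^ 2 * (ε⁻¹ * Real.exp (ε * ‖y‖ ^ 2)) := by
    calc _ ≤ (T * ‖y‖) ^ 2 := by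
          gcongr
          exact ContinuousLinearMap.le_opNorm _ _
      _ = T ^ 2 * ‖y‖ ^ 2 := by ring
      _ ≤ _ := by
          gcongr
          exact norm_sq_le_inv_mul_exp hε y
  have he := one_le_exp_mul_norm_sq hε y
  have h4 : |Real.log B| + |Real.log c| + ‖η‖ ^ 2 ≤
      (|Real.log B| + |Real.log c| + ‖η‖ ^ 2) * Real.exp (ε * ‖y‖ ^ 2) :=
    le_mul_of_one_le_right (by positivity) he
  have h5 : 0 ≤ T ^ 2 * (ε⁻¹ * Real.exp (ε * ‖y‖ ^ 2)) := by positivity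
  have h6 := neg_abs_le (Real.log c)
  have h7 := abs_nonneg (Real.log c)
  have h8 := abs_nonneg (Real.log B)
  rw [abs_le]
  constructor <;> nlinarith [sq_nonneg ‖η‖]

lemma exists_abs_logRatio_le (h : IsMultiwell G V₀ xt x) (η : EuclideanSpace ℝ (Fin d))
    (j : Fin n) {ε : ℝ} (hε : 0 < ε) :
    ∃ K, ∀ᶠ N : ℕ in atTop, ∀ y,
      |logRatio G V₀ xt η x N (x j + (√(N : ℝ))⁻¹ • y)| ≤ K * Real.exp (ε * ‖y‖ ^ 2) := by
  obtain ⟨M, hM⟩ := h.growth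
  have hM0 : 0 ≤ M :=
    nonneg_of_mul_nonneg_left ((sq_nonneg _).trans (hM 0).1) (Real.exp_pos _)
  obtain ⟨K₁, hK₁⟩ := h.exists_abs_log_rescaledCompetitor_le η j hε
  obtain ⟨K₂, hK₂⟩ := exists_misfit_le h.contDiff (fun z ↦ (hM z).1) (x j) η hε
  have hlog := ((h.tendsto_normalizationConst η).log h.sum_laplaceMass_pos.ne').abs
  set K₃ := |Real.log (∑ k, laplaceMass G V₀ (x k))| + 1
  refine ⟨K₁ + K₃ + K₂ + M * Real.exp (2 * ‖x j‖ ^ 2), ?_⟩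
  filter_upwards [hK₂, hlog.eventually_lt_const (lt_add_one _), eventually_two_le_mul_sqrt_sq hε,
    eventually_ge_atTop 1] with N h2 h3 hN hN1 y
  obtain ⟨hs, hN⟩ := hN
  have h4 : V₀ (x j + (√(N : ℝ))⁻¹ • y) ≤
      M * (Real.exp (2 * ‖x j‖ ^ 2) * Real.exp (ε * ‖y‖ ^ 2)) :=
    (hM _).2.trans (mul_le_mul_of_nonneg_left (exp_norm_add_sq_le hs hN _ _) hM0)
  have h5 : K₃ ≤ K₃ * Real.exp (ε * ‖y‖ ^ 2) :=
    le_mul_of_one_le_right (by positivity) (one_le_exp_mul_norm_sq hε y)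
  have h6 : |1 / 2 * ‖√(N : ℝ) • (G (x j) - G (x j + (√(N : ℝ))⁻¹ • y)) + η‖ ^ 2| ≤
      K₂ * Real.exp (ε * ‖y‖ ^ 2) := by
    rw [abs_of_nonneg (by positivity)]
    exact h2 y
  have h7 : |V₀ (x j + (√(N : ℝ))⁻¹ • y)| ≤
      M * (Real.exp (2 * ‖x j‖ ^ 2) * Real.exp (ε * ‖y‖ ^ 2)) := by
    rwa [abs_of_nonneg (h.nonneg _)]
  rw [h.logRatio_add_smul η hN1]
  refine (abs_add_le _ _).trans ?_
  refine (add_le_add_left ((abs_add_le _ _).trans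
    (add_le_add_left (abs_add_le _ _) _)) _).trans ?_
  linarith [hK₁ N y]

lemma measurable_logRatio (h : IsMultiwell G V₀ xt x) (η : EuclideanSpace ℝ (Fin d)) (N : ℕ) :
    Measurable (logRatio G V₀ xt η x N) := by
  have h1 := (continuous_unnormalizedDensity (xt := xt) (η := η)
    h.contDiff.continuous h.continuous N).measurable
  have h2 := (continuous_competitorDensity (G := G) (V₀ := V₀) (η := η) (x := x) N).measurable
  exact (h2.div (h1.const_mul _)).log

lemma tendsto_integral_gaussianDensity_mul_logRatio (h : IsMultiwell G V₀ xt x)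
    (η : EuclideanSpace ℝ (Fin d)) (j : Fin n) :
    (∀ᶠ N : ℕ in atTop, Integrable fun y ↦ gaussianDensity (jacobian G (x j)) η y *
      logRatio G V₀ xt η x N (x j + (√(N : ℝ))⁻¹ • y)) ∧
    Tendsto (fun N : ℕ ↦ ∫ y, gaussianDensity (jacobian G (x j)) η y *
      logRatio G V₀ xt η x N (x j + (√(N : ℝ))⁻¹ • y)) atTop (𝓝 0) := by
  obtain ⟨ε, hε, C, hC, hle⟩ := exists_gaussianDensity_le (h.det_ne_zero j) η
  obtain ⟨K, hK⟩ := h.exists_abs_logRatio_le η j hε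
  have hmeas : ∀ N : ℕ, AEStronglyMeasurable (fun y ↦ gaussianDensity (jacobian G (x j)) η y *
      logRatio G V₀ xt η x N (x j + (√(N : ℝ))⁻¹ • y)) volume := fun N ↦
    ((continuous_gaussianDensity _ _).measurable.mul
      ((h.measurable_logRatio η N).comp (by fun_prop))).aestronglyMeasurable
  have hbound : ∀ᶠ N : ℕ in atTop, ∀ᵐ y, ‖gaussianDensity (jacobian G (x j)) η y *
      logRatio G V₀ xt η x N (x j + (√(N : ℝ))⁻¹ • y)‖ ≤
      C * K * Real.exp (-(ε * ‖y‖ ^ 2)) := by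
    filter_upwards [hK] with N hN
    refine ae_of_all _ fun y ↦ ?_
    have hg := gaussianDensity_pos (h.det_ne_zero j) η y
    rw [norm_mul, Real.norm_of_nonneg hg.le, Real.norm_eq_abs]
    calc _ ≤ C * Real.exp (-(2 * ε * ‖y‖ ^ 2)) * (K * Real.exp (ε * ‖y‖ ^ 2)) :=
          mul_le_mul (hle y) (hN y) (abs_nonneg _) (by positivity)
      _ = C * K * (Real.exp (-(2 * ε * ‖y‖ ^ 2)) * Real.exp (ε * ‖y‖ ^ 2)) := by ring
      _ = _ := by
        rw [← Real.exp_add]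
        ring_nf
  have hint : Integrable fun y : EuclideanSpace ℝ (Fin d) ↦
      C * K * Real.exp (-(ε * ‖y‖ ^ 2)) := (integrable_exp_neg_mul_norm_sq hε).const_mul _
  refine ⟨hbound.mono fun N hN ↦ hint.mono' (hmeas N) hN, ?_⟩
  have := tendsto_integral_filter_of_dominated_convergence _ (Eventually.of_forall hmeas) hbound
    hint (f := fun _ ↦ 0) (ae_of_all _ fun y ↦ ?_)
  · simpa using this
  · simpa using (h.tendsto_logRatio η j y).const_mul (gaussianDensity (jacobian G (x j)) η y)

/-- The competitor has asymptotically vanishing divergence from the posterior. -/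
lemma tendsto_klDiv_competitor (h : IsMultiwell G V₀ xt x) (η : EuclideanSpace ℝ (Fin d)) :
    Tendsto (fun N : ℕ ↦ klDiv (mixture (limitWeight G V₀ x) (competitorMean G η x N)
      (fun j ↦ (1 / (N : ℝ)) • limitCov G (x j))) (smallNoisePosterior G V₀ xt η N)) atTop
      (𝓝 0) := by
  have hlim := ENNReal.tendsto_ofReal (tendsto_finsetSum Finset.univ fun j _ ↦
    (h.tendsto_integral_gaussianDensity_mul_logRatio η j).2.const_mul (limitWeight G V₀ x j))
  simp only [mul_zero, Finset.sum_const_zero, ENNReal.ofReal_zero] at hlim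
  refine hlim.congr' ?_
  filter_upwards [eventually_ge_atTop 1, eventually_all.2 fun j ↦
    (h.tendsto_integral_gaussianDensity_mul_logRatio η j).1] with N hN hint
  have hs : 0 < √(N : ℝ) := Real.sqrt_pos.2 (by exact_mod_cast hN)
  have hZ := h.normalizationConst_pos η N
  have hcancel : ∀ (j : Fin n) (y : EuclideanSpace ℝ (Fin d)),
      √(N : ℝ) • (x j + (√(N : ℝ))⁻¹ • y - x j) = y := fun j y ↦ by
    rw [add_sub_cancel_left, smul_smul, mul_inv_cancel₀ hs.ne', one_smul]
  have hgi : ∀ j, Integrable fun z ↦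
      √(N : ℝ) ^ d * gaussianDensity (jacobian G (x j)) η (√(N : ℝ) • (z - x j)) := by
    refine fun j ↦ Integrable.const_mul ((integrable_iff_comp_add_smul hs (x j) _).1 ?_) _
    simp_rw [hcancel]
    exact integrable_gaussianDensity (h.det_ne_zero j) η
  have hli : ∀ j, Integrable fun z ↦ √(N : ℝ) ^ d *
      (gaussianDensity (jacobian G (x j)) η (√(N : ℝ) • (z - x j)) *
        logRatio G V₀ xt η x N z) := by
    refine fun j ↦ Integrable.const_mul ((integrable_iff_comp_add_smul hs (x j) _).1 ?_) _
    simp_rw [hcancel]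
    exact hint j
  have hpi : Integrable (competitorDensity G V₀ η x N) :=
    integrable_finsetSum _ fun j _ ↦ (hgi j).const_mul _
  have hp1 : ∫ z, competitorDensity G V₀ η x N z = 1 := by
    simp only [competitorDensity]
    rw [integral_finsetSum _ fun j _ ↦ (hgi j).const_mul _, ← h.sum_limitWeight]
    refine Finset.sum_congr rfl fun j _ ↦ ?_
    rw [integral_const_mul, integral_const_mul, ← smul_eq_mul (√(N : ℝ) ^ d),
      pow_mul_integral_eq_integral_comp hs (x j)]
    simp_rw [hcancel]
    rw [integral_gaussianDensity (h.det_ne_zero j), mul_one]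
  have hq1 : ∫ z, (normalizationConst G V₀ xt η N)⁻¹ * unnormalizedDensity G V₀ xt η N z = 1 := by
    rw [integral_const_mul, ← normalizationConst, inv_mul_cancel₀ hZ.ne']
  -- The outer factor of the integrand splits over the components while the logarithm keeps the
  -- whole mixture; each summand is then rescaled about its own centre.
  have hexp : ∀ z, competitorDensity G V₀ η x N z *
      Real.log (competitorDensity G V₀ η x N z /
        ((normalizationConst G V₀ xt η N)⁻¹ * unnormalizedDensity G V₀ xt η N z)) =
      ∑ j, limitWeight G V₀ x j * (√(N : ℝ) ^ d *
        (gaussianDensity (jacobian G (x j)) η (√(N : ℝ) • (z - x j)) *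
          logRatio G V₀ xt η x N z)) := by
    intro z
    rw [← logRatio, competitorDensity, Finset.sum_mul]
    refine Finset.sum_congr rfl fun j _ ↦ ?_
    ring
  rw [h.mixture_competitor η hN, smallNoisePosterior, klDiv_withDensity_ofReal
    (continuous_competitorDensity N).measurable
    ((continuous_unnormalizedDensity h.contDiff.continuous h.continuous N).measurable.const_mul _)
    (h.competitorDensity_pos η hN)
    (fun z ↦ mul_pos (inv_pos.2 hZ) (unnormalizedDensity_pos N z)) hpi
    ((h.integrable_unnormalizedDensity η N).const_mul _) (hp1.trans hq1.symm)]
  · congr 1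
    simp_rw [hexp]
    rw [integral_finsetSum _ fun j _ ↦ (hli j).const_mul _]
    refine Finset.sum_congr rfl fun j _ ↦ ?_
    rw [integral_const_mul, integral_const_mul, ← smul_eq_mul (√(N : ℝ) ^ d),
      pow_mul_integral_eq_integral_comp hs (x j)]
    simp_rw [hcancel]
  · simp_rw [hexp]
    exact integrable_finsetSum _ fun j _ ↦ (hli j).const_mul _

end IsMultiwell

-- Concentration of Gaussians that charge small balls

lemma gaussianReal_real_ball_le (m : ℝ) {v : NNReal} (hv : v ≠ 0) (c : ℝ) {r : ℝ} (hr : 0 ≤ r) :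
    (gaussianReal m v).real (Metric.ball c r) ≤ (√(2 * Real.pi * v))⁻¹ * (2 * r) := by
  refine ENNReal.toReal_le_of_le_ofReal (by positivity) ?_
  rw [gaussianReal_apply m hv]
  calc ∫⁻ t in Metric.ball c r, gaussianPDF m v t
      ≤ ∫⁻ _ in Metric.ball c r, ENNReal.ofReal (√(2 * Real.pi * v))⁻¹ := by
        refine lintegral_mono fun t ↦ ENNReal.ofReal_le_ofReal ?_
        refine mul_le_of_le_one_right (by positivity) (Real.exp_le_one_iff.2 ?_)
        rw [neg_div]
        exact neg_nonpos.2 (by positivity)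
    _ = ENNReal.ofReal ((√(2 * Real.pi * v))⁻¹ * (2 * r)) := by
        rw [setLIntegral_const, Real.volume_ball, ← ENNReal.ofReal_mul (by positivity)]

/-- The density is at most `1/√(2πv)`, so `n` intervals of length `2r` carry mass at most
`2nr/√(2πv)`; mass `3/4` forces `v` to be of order `(nr)²`. -/
lemma variance_le_of_gaussianReal_iUnion (m : ℝ) (v : NNReal) (c : Fin n → ℝ) {r : ℝ} (hr : 0 ≤ r)
    (h : 3 / 4 ≤ (gaussianReal m v).real (⋃ k, Metric.ball (c k) r)) :
    (v : ℝ) ≤ 2 * (n * r) ^ 2 := by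
  by_cases hv : v = 0
  · rw [hv, NNReal.coe_zero]
    positivity
  have hv0 : (0 : ℝ) < v := by positivity
  have hw : 0 < 2 * Real.pi * v := by positivity
  have h1 := (measureReal_iUnion_fintype_le (μ := gaussianReal m v)
    fun k ↦ Metric.ball (c k) r).trans
    (Finset.sum_le_sum fun k _ ↦ gaussianReal_real_ball_le m hv (c k) hr)
  rw [Finset.sum_const, Finset.card_univ, Fintype.card_fin, nsmul_eq_mul] at h1
  have h2 : 3 / 4 * √(2 * Real.pi * v) ≤ n * (2 * r) := by
    have h3 := mul_le_mul_of_nonneg_right (h.trans h1) (Real.sqrt_nonneg (2 * Real.pi * v))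
    have h4 : √(2 * Real.pi * v) ≠ 0 := (Real.sqrt_pos.2 hw).ne'
    calc _ ≤ _ := h3
      _ = _ := by field_simp
  have h3 : (3 / 4 * √(2 * Real.pi * v)) ^ 2 ≤ (n * (2 * r)) ^ 2 := by gcongr
  rw [mul_pow, Real.sq_sqrt hw.le] at h3
  nlinarith [Real.pi_gt_three]

lemma integral_norm_sub_sq_multivariateGaussian {S : Matrix (Fin d) (Fin d) ℝ}
    (hS : S.PosSemidef) (m : EuclideanSpace ℝ (Fin d)) :
    Integrable (fun z ↦ ‖z - m‖ ^ 2) (multivariateGaussian m S) ∧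
      ∫ z, ‖z - m‖ ^ 2 ∂multivariateGaussian m S = ∑ j, S j j := by
  have hmem : MemLp id 2 (multivariateGaussian m S) := IsGaussian.memLp_two_id
  have hint : Integrable (fun z ↦ ‖z - m‖ ^ 2) (multivariateGaussian m S) :=
    (hmem.sub (memLp_const m)).integrable_norm_pow two_ne_zero
  have hj : ∀ j, MemLp (fun z : EuclideanSpace ℝ (Fin d) ↦ z j) 2 (multivariateGaussian m S) :=
    fun j ↦ (EuclideanSpace.proj (𝕜 := ℝ) j).comp_memLp' hmem
  refine ⟨hint, ?_⟩
  simp_rw [EuclideanSpace.real_norm_sq_eq]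
  have hji : ∀ j ∈ Finset.univ, Integrable (fun z : EuclideanSpace ℝ (Fin d) ↦ (z - m) j ^ 2)
      (multivariateGaussian m S) := fun j _ ↦ ((hj j).sub (memLp_const (m j))).integrable_sq
  rw [integral_finsetSum _ hji]
  refine Finset.sum_congr rfl fun j _ ↦ ?_
  rw [← variance_eval_multivariateGaussian (μ := m) hS j, variance_eq_integral (by fun_prop)]
  have hm : ∫ z : EuclideanSpace ℝ (Fin d), z j ∂multivariateGaussian m S = m j := by
    have := (EuclideanSpace.proj (𝕜 := ℝ) j).integral_comp_comm
      (φ := fun z ↦ z) (hmem.integrable (by norm_num))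
    simpa using this
  rw [hm]
  rfl

/-- A Gaussian measure which charges mostly small balls around finitely many points is concentrated
near one of them. -/
lemma exists_concentrated (x : Fin n → EuclideanSpace ℝ (Fin d)) {s δ : ℝ} (hs : 0 < s)
    (hδ : 0 < δ) :
    ∃ r₀ > 0, ∀ r, 0 < r → r < r₀ → ∀ (m : EuclideanSpace ℝ (Fin d))
      (S : Matrix (Fin d) (Fin d) ℝ), S.PosSemidef →
      3 / 4 ≤ (multivariateGaussian m S).real (⋃ k, Metric.ball (x k) r) →
      ∃ k, dist m (x k) < s ∧
        1 - δ ≤ (multivariateGaussian m S).real (Metric.ball (x k) s) := by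
  -- One third for the tail around the mean, one for meeting a point within `a` of the mean, one for
  -- the distance `r < a` from that point to `xₖ`.
  set a := s / 3 with ha
  have ha0 : 0 < a := by positivity
  have hlim : Tendsto (fun r : ℝ ↦ d * (2 * (n * r) ^ 2) / a ^ 2) (𝓝 0) (𝓝 0) := by
    have : Continuous fun r : ℝ ↦ d * (2 * (n * r) ^ 2) / a ^ 2 := by fun_prop
    simpa using this.tendsto 0
  have hev := (hlim.eventually_lt_const (lt_min hδ (by norm_num : (0 : ℝ) < 1 / 4))).and
    (gt_mem_nhds ha0)
  obtain ⟨r₀, hr₀, hball⟩ := Metric.eventually_nhds_iff.1 hev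
  refine ⟨r₀, hr₀, fun r hr hrr m S hS hU ↦ ?_⟩
  obtain ⟨hsmall, hra⟩ := hball 
    (show dist r 0 < r₀ by rwa [dist_zero_right, Real.norm_of_nonneg hr.le])
  set P := multivariateGaussian m S with hP
  -- Coordinate projections send balls into intervals of the same radius, so the one-dimensional
  -- bound controls each diagonal entry.
  have hvar : ∀ j, S j j ≤ 2 * (n * r) ^ 2 := by
    intro j
    have hmp := measurePreserving_eval_multivariateGaussian (μ := m) hS (i := j)
    have h1 : 3 / 4 ≤ (gaussianReal (m j) (S j j).toNNReal).real
        (⋃ k, Metric.ball (x k j) r) := by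
      have hmeas : MeasurableSet (⋃ k, Metric.ball (x k j) r) :=
        MeasurableSet.iUnion fun _ ↦ measurableSet_ball
      rw [measureReal_def, ← hmp.measure_preimage hmeas.nullMeasurableSet, ← measureReal_def]
      refine hU.trans (measureReal_mono ?_)
      rw [Set.preimage_iUnion]
      refine Set.iUnion_mono fun k z hz ↦ ?_
      rw [Set.mem_preimage, Metric.mem_ball, Real.dist_eq]
      rw [Metric.mem_ball, dist_eq_norm] at hz
      refine lt_of_le_of_lt ?_ hz
      simpa using PiLp.norm_apply_le (z - x k) j
    have h2 := variance_le_of_gaussianReal_iUnion _ _ _ hr.le h1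
    rwa [Real.coe_toNNReal _ hS.diag_nonneg] at h2
  obtain ⟨hint, hval⟩ := integral_norm_sub_sq_multivariateGaussian hS m
  have hcheb := mul_meas_ge_le_integral_of_nonneg (ae_of_all _ fun z ↦ sq_nonneg ‖z - m‖) hint
    (a ^ 2)
  have htr : ∑ j, S j j ≤ d * (2 * (n * r) ^ 2) := by
    have := Finset.sum_le_sum (s := Finset.univ) fun j _ ↦ hvar j
    simpa using this
  have hcompl : (Metric.ball m a)ᶜ = {z | a ^ 2 ≤ ‖z - m‖ ^ 2} := by
    ext z
    rw [Set.mem_compl_iff, Metric.mem_ball, not_lt, dist_eq_norm, Set.mem_ofPred_eq,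
      sq_le_sq₀ ha0.le (norm_nonneg _)]
  have htail : P.real (Metric.ball m a)ᶜ < min δ (1 / 4) := by
    refine lt_of_le_of_lt ?_ hsmall
    rw [hcompl, le_div_iff₀ (by positivity), mul_comm]
    rw [hval] at hcheb
    exact hcheb.trans htr
  have hmass : P.real (Metric.ball m a) = 1 - P.real (Metric.ball m a)ᶜ := by
    rw [probReal_compl_eq_one_sub measurableSet_ball]
    ring
  -- Two sets of mass at least `3/4` and more than `3/4` cannot be disjoint.
  have hne : ((⋃ k, Metric.ball (x k) r) ∩ Metric.ball m a).Nonempty := by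
    rw [Set.nonempty_iff_ne_empty]
    intro he
    have hd : Disjoint (⋃ k, Metric.ball (x k) r) (Metric.ball m a) :=
      Set.disjoint_iff_inter_eq_empty.2 he
    have h1 := measureReal_union (μ := P) hd measurableSet_ball
    have h2 : P.real ((⋃ k, Metric.ball (x k) r) ∪ Metric.ball m a) ≤ 1 := measureReal_le_one
    linarith [htail.trans_le (min_le_right δ (1 / 4))]
  obtain ⟨z, hzU, hzm⟩ := hne
  obtain ⟨k, hk⟩ := Set.mem_iUnion.1 hzU
  have hdist : dist m (x k) < 2 * a := by
    calc dist m (x k) ≤ dist z m + dist z (x k) := dist_triangle_left _ _ _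
      _ < a + a := add_lt_add hzm (lt_trans hk hra)
      _ = 2 * a := by ring
  refine ⟨k, by linarith, ?_⟩
  have hsub : Metric.ball m a ⊆ Metric.ball (x k) s :=
    Metric.ball_subset_ball' (by linarith)
  have := measureReal_mono (μ := P) hsub
  linarith [htail.trans_le (min_le_left δ (1 / 4))]

-- Elementary facts about mixtures and covariance matrices

section Mixture

variable {α : Fin n → ℝ} {m : Fin n → EuclideanSpace ℝ (Fin d)}
  {S : Fin n → Matrix (Fin d) (Fin d) ℝ}

lemma mixture_comp_perm (σ : Equiv.Perm (Fin n)) :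
    mixture (fun i ↦ α (σ i)) (fun i ↦ m (σ i)) (fun i ↦ S (σ i)) = mixture α m S :=
  Equiv.sum_comp σ fun i ↦ ENNReal.ofReal (α i) • multivariateGaussian (m i) (S i)

lemma mixture_real (hα : ∀ i, 0 ≤ α i) (A : Set (EuclideanSpace ℝ (Fin d))) :
    (mixture α m S).real A = ∑ i, α i * (multivariateGaussian (m i) (S i)).real A := by
  rw [measureReal_def, mixture, Measure.finsetSum_apply, ENNReal.toReal_sum]
  · refine Finset.sum_congr rfl fun i _ ↦ ?_
    rw [Measure.smul_apply, smul_eq_mul, ENNReal.toReal_mul, ENNReal.toReal_ofReal (hα i),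
      measureReal_def]
  · intro i _
    rw [Measure.smul_apply, smul_eq_mul]
    exact ENNReal.mul_ne_top ENNReal.ofReal_ne_top (measure_ne_top _ _)

lemma isProbabilityMeasure_mixture (hα : ∀ i, 0 ≤ α i) (h1 : ∑ i, α i = 1) :
    IsProbabilityMeasure (mixture α m S) := by
  constructor
  rw [mixture, Measure.finsetSum_apply]
  simp only [Measure.smul_apply, measure_univ, smul_eq_mul, mul_one]
  rw [← ENNReal.ofReal_sum_of_nonneg fun i _ ↦ hα i, h1, ENNReal.ofReal_one]

lemma integral_mixture (hα : ∀ i, 0 ≤ α i) {ψ : EuclideanSpace ℝ (Fin d) → ℂ}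
    (hψ : Measurable ψ) (hψ1 : ∀ z, ‖ψ z‖ ≤ 1) :
    ∫ z, ψ z ∂mixture α m S = ∑ i, α i • ∫ z, ψ z ∂multivariateGaussian (m i) (S i) := by
  have hint : ∀ i, Integrable ψ (multivariateGaussian (m i) (S i)) := fun i ↦
    (integrable_const (1 : ℝ)).mono' hψ.aestronglyMeasurable (ae_of_all _ hψ1)
  rw [mixture, integral_finsetSum_measure fun i _ ↦
    (hint i).smul_measure ENNReal.ofReal_ne_top]
  refine Finset.sum_congr rfl fun i _ ↦ ?_
  rw [integral_smul_measure, ENNReal.toReal_ofReal (hα i)]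

end Mixture

lemma IsSeparated.comp_perm {ξ₁ ξ₂ : ℝ} {α : Fin n → ℝ} {m : Fin n → EuclideanSpace ℝ (Fin d)}
    {S : Fin n → Matrix (Fin d) (Fin d) ℝ} (h : IsSeparated ξ₁ ξ₂ α m S)
    (σ : Equiv.Perm (Fin n)) :
    IsSeparated ξ₁ ξ₂ (fun i ↦ α (σ i)) (fun i ↦ m (σ i)) (fun i ↦ S (σ i)) where
  le_weight _ := h.le_weight _
  sum_weight := (Equiv.sum_comp σ α).trans h.sum_weight
  le_dist _ _ hij := h.le_dist _ _ (σ.injective.ne hij)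
  posSemidef _ := h.posSemidef _

lemma norm_integral_indicator_le {P : Measure (EuclideanSpace ℝ (Fin d))} [IsFiniteMeasure P]
    {A : Set (EuclideanSpace ℝ (Fin d))} (hA : MeasurableSet A)
    {ψ : EuclideanSpace ℝ (Fin d) → ℂ} (hψ1 : ∀ z, ‖ψ z‖ ≤ 1) :
    ‖∫ z, A.indicator ψ z ∂P‖ ≤ P.real A := by
  rw [integral_indicator hA]
  simpa using norm_setIntegral_le_of_norm_le_const (μ := P) (s := A) (C := 1)
    (measure_lt_top _ _) fun z _ ↦ hψ1 z

lemma IsSeparated.isProbabilityMeasure {ξ₁ ξ₂ : ℝ} {α : Fin n → ℝ}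
    {m : Fin n → EuclideanSpace ℝ (Fin d)} {S : Fin n → Matrix (Fin d) (Fin d) ℝ}
    (h : IsSeparated ξ₁ ξ₂ α m S) (hξ₁ : 0 < ξ₁) : IsProbabilityMeasure (mixture α m S) :=
  isProbabilityMeasure_mixture (fun i ↦ hξ₁.le.trans (h.le_weight i)) h.sum_weight

lemma IsSeparated.weight_le_one {ξ₁ ξ₂ : ℝ} {α : Fin n → ℝ}
    {m : Fin n → EuclideanSpace ℝ (Fin d)} {S : Fin n → Matrix (Fin d) (Fin d) ℝ}
    (h : IsSeparated ξ₁ ξ₂ α m S) (hξ₁ : 0 < ξ₁) (i : Fin n) : α i ≤ 1 :=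
  h.sum_weight ▸ Finset.single_le_sum (fun j _ ↦ hξ₁.le.trans (h.le_weight j)) (Finset.mem_univ i)

lemma isSymm_of_posSemidef {A : Matrix (Fin d) (Fin d) ℝ} (hA : A.PosSemidef) : A.IsSymm := by
  rw [IsSymm, ← conjTranspose_eq_transpose_of_trivial]
  exact hA.isHermitian

/-- By polarisation, the entries of a symmetric matrix are combinations of finitely many values of
its quadratic form. -/
lemma tendsto_of_tendsto_quadratic {ι : Type*} {l : Filter ι}
    {S : ι → Matrix (Fin d) (Fin d) ℝ} {C : Matrix (Fin d) (Fin d) ℝ}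
    (hS : ∀ᶠ N in l, (S N).IsSymm) (hC : C.IsSymm)
    (h : ∀ t : Fin d → ℝ, Tendsto (fun N ↦ t ⬝ᵥ S N *ᵥ t) l (𝓝 (t ⬝ᵥ C *ᵥ t))) :
    Tendsto S l (𝓝 C) := by
  have hpol : ∀ A : Matrix (Fin d) (Fin d) ℝ, A.IsSymm → ∀ i j,
      A i j = ((Pi.single i 1 + Pi.single j 1) ⬝ᵥ A *ᵥ (Pi.single i 1 + Pi.single j 1) -
        Pi.single i 1 ⬝ᵥ A *ᵥ Pi.single i 1 - Pi.single j 1 ⬝ᵥ A *ᵥ Pi.single j 1) / 2 := by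
    intro A hA i j
    have := hA.apply i j
    simp only [mulVec_add, add_dotProduct, dotProduct_add, mulVec_single_one,
      single_one_dotProduct, col_apply]
    linarith
  refine tendsto_pi_nhds.2 fun i ↦ tendsto_pi_nhds.2 fun j ↦ ?_
  rw [hpol C hC i j]
  refine Tendsto.congr' (hS.mono fun N hN ↦ (hpol (S N) hN i j).symm) ?_
  exact (((h _).sub (h _)).sub (h _)).div_const 2

-- Convergence of the parameters of near-optimal mixtures

namespace IsMultiwell

variable {ξ₁ ξ₂ : ℝ} {α : ℕ → Fin n → ℝ} {m : ℕ → Fin n → EuclideanSpace ℝ (Fin d)}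
  {S : ℕ → Fin n → Matrix (Fin d) (Fin d) ℝ}

lemma tendsto_mixture_sub_posterior (h : IsMultiwell G V₀ xt x) (hξ₁ : 0 < ξ₁)
    (hsep : ∀ N, 1 ≤ N → IsSeparated ξ₁ ξ₂ (α N) (m N) (S N))
    (hkl : Tendsto (fun N ↦ klDiv (mixture (α N) (m N) (S N))
      (smallNoisePosterior G V₀ xt η N)) atTop (𝓝 0))
    {ψ : ℕ → EuclideanSpace ℝ (Fin d) → ℂ} (hψ : ∀ N, Measurable (ψ N))
    (hψ1 : ∀ N z, ‖ψ N z‖ ≤ 1) :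
    Tendsto (fun N ↦ ∫ z, ψ N z ∂mixture (α N) (m N) (S N) -
      ∫ z, ψ N z ∂smallNoisePosterior G V₀ xt η N) atTop (𝓝 0) := by
  refine tendsto_integral_sub_integral_of_klDiv
    (Eventually.of_forall fun N ↦ h.isProbabilityMeasure η N) ?_ hkl hψ hψ1
  filter_upwards [eventually_ge_atTop 1] with N hN
  exact (hsep N hN).isProbabilityMeasure hξ₁

lemma tendsto_mixture_real_ball (h : IsMultiwell G V₀ xt x) (hξ₁ : 0 < ξ₁)
    (hsep : ∀ N, 1 ≤ N → IsSeparated ξ₁ ξ₂ (α N) (m N) (S N))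
    (hkl : Tendsto (fun N ↦ klDiv (mixture (α N) (m N) (S N))
      (smallNoisePosterior G V₀ xt η N)) atTop (𝓝 0))
    (k : Fin n) {r : ℝ} (hr : 0 < r)
    (hloc : ∃ κ > 0, ∀ v, ‖v‖ < r → κ * ‖v‖ ≤ ‖G (x k + v) - G (x k)‖) :
    Tendsto (fun N ↦ (mixture (α N) (m N) (S N)).real (Metric.ball (x k) r)) atTop
      (𝓝 (limitWeight G V₀ x k)) := by
  have h1 := h.tendsto_mixture_sub_posterior hξ₁ hsep hkl
    (ψ := fun _ ↦ (Metric.ball (x k) r).indicator fun _ ↦ 1)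
    (fun _ ↦ measurable_const.indicator measurableSet_ball)
    (fun _ z ↦ (norm_indicator_le_norm_self _ _).trans (by simp))
  have h2 := (Complex.continuous_re.tendsto _).comp h1
  simp only [Function.comp_def, integral_indicator measurableSet_ball, setIntegral_const,
    Complex.sub_re, Complex.real_smul, mul_one, Complex.ofReal_re, Complex.zero_re] at h2
  simpa using h2.add (h.tendsto_posterior_real_ball η k hr hloc)

/-- The mixture eventually leaves mass less than `ξ₁ / 4` outside the balls; a component of weight
at least `ξ₁` can therefore leave at most `1 / 4` of its own mass there. -/
lemma eventually_mass_iUnion_ball (h : IsMultiwell G V₀ xt x) (hξ₁ : 0 < ξ₁)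
    (hsep : ∀ N, 1 ≤ N → IsSeparated ξ₁ ξ₂ (α N) (m N) (S N))
    (hkl : Tendsto (fun N ↦ klDiv (mixture (α N) (m N) (S N))
      (smallNoisePosterior G V₀ xt η N)) atTop (𝓝 0)) {r : ℝ} (hr : 0 < r)
    (hloc : ∀ k, ∃ κ > 0, ∀ v, ‖v‖ < r → κ * ‖v‖ ≤ ‖G (x k + v) - G (x k)‖)
    (hdisj : Pairwise (Function.onFun Disjoint fun k ↦ Metric.ball (x k) r)) :
    ∀ᶠ N in atTop, ∀ i,
      3 / 4 ≤ (multivariateGaussian (m N i) (S N i)).real (⋃ k, Metric.ball (x k) r) := by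
  have hsum := tendsto_finsetSum Finset.univ fun k _ ↦
    h.tendsto_mixture_real_ball hξ₁ hsep hkl k hr (hloc k)
  rw [h.sum_limitWeight] at hsum
  filter_upwards [hsum.eventually_const_lt (show 1 - ξ₁ / 4 < 1 by linarith),
    eventually_ge_atTop 1] with N hN hN1 i
  have hs := hsep N hN1
  have := hs.isProbabilityMeasure hξ₁
  have hα : ∀ i, 0 ≤ α N i := fun i ↦ hξ₁.le.trans (hs.le_weight i)
  set U := ⋃ k, Metric.ball (x k) r with hU
  have h1 : (mixture (α N) (m N) (S N)).real U =
      ∑ k, (mixture (α N) (m N) (S N)).real (Metric.ball (x k) r) :=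
    measureReal_iUnion_fintype hdisj fun _ ↦ measurableSet_ball
  rw [← h1, mixture_real hα] at hN
  have h2 : α N i * (1 - (multivariateGaussian (m N i) (S N i)).real U) ≤
      ∑ l, α N l * (1 - (multivariateGaussian (m N l) (S N l)).real U) :=
    Finset.single_le_sum (f := fun l ↦ α N l * (1 - (multivariateGaussian (m N l) (S N l)).real U))
      (fun l _ ↦ mul_nonneg (hα l) (sub_nonneg.2 measureReal_le_one)) (Finset.mem_univ i)
  simp_rw [mul_sub, mul_one, Finset.sum_sub_distrib] at h2
  rw [hs.sum_weight, ← mul_one_sub] at h2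
  have h3 : ξ₁ * (1 - (multivariateGaussian (m N i) (S N i)).real U) ≤
      α N i * (1 - (multivariateGaussian (m N i) (S N i)).real U) :=
    mul_le_mul_of_nonneg_right (hs.le_weight i) (sub_nonneg.2 measureReal_le_one)
  have h4 : ξ₁ * (1 - (multivariateGaussian (m N i) (S N i)).real U) ≤ ξ₁ * (1 / 4) := by linarith
  linarith [le_of_mul_le_mul_left h4 hξ₁]

lemma eventually_concentrated (h : IsMultiwell G V₀ xt x) (hξ₁ : 0 < ξ₁)
    (hsep : ∀ N, 1 ≤ N → IsSeparated ξ₁ ξ₂ (α N) (m N) (S N))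
    (hkl : Tendsto (fun N ↦ klDiv (mixture (α N) (m N) (S N))
      (smallNoisePosterior G V₀ xt η N)) atTop (𝓝 0)) {s δ : ℝ} (hs : 0 < s) (hδ : 0 < δ) :
    ∀ᶠ N in atTop, ∀ i, ∃ k, dist (m N i) (x k) < s ∧
      1 - δ ≤ (multivariateGaussian (m N i) (S N i)).real (Metric.ball (x k) s) := by
  obtain ⟨r₀, hr₀, hconc⟩ := exists_concentrated x hs hδ
  obtain ⟨r, ⟨hloc, hdisj⟩, hr⟩ :=
    ((h.eventually_local.and h.eventually_disjoint).and (Ioo_mem_nhdsGT hr₀)).exists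
  filter_upwards [h.eventually_mass_iUnion_ball hξ₁ hsep hkl hr.1 hloc hdisj,
    eventually_ge_atTop 1] with N hN hN1 i
  exact hconc r hr.1 hr.2 _ _ ((hsep N hN1).posSemidef i) (hN i)

/-- The components can be relabelled so that the `k`-th one concentrates at `xₖ`. -/
lemma exists_perm (h : IsMultiwell G V₀ xt x) (hξ₁ : 0 < ξ₁) (hξ₂ : 0 < ξ₂)
    (hsep : ∀ N, 1 ≤ N → IsSeparated ξ₁ ξ₂ (α N) (m N) (S N))
    (hkl : Tendsto (fun N ↦ klDiv (mixture (α N) (m N) (S N))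
      (smallNoisePosterior G V₀ xt η N)) atTop (𝓝 0)) :
    ∃ σ : ℕ → Equiv.Perm (Fin n), ∀ k, Tendsto (fun N ↦ m N (σ N k)) atTop (𝓝 (x k)) ∧
      ∀ s, 0 < s → Tendsto (fun N ↦ (multivariateGaussian (m N (σ N k)) (S N (σ N k))).real
        (Metric.ball (x k) s)) atTop (𝓝 1) := by
  have := h.nonempty
  -- Choosing the nearest solution makes the assignment independent of the scale `s`, so one
  -- sequence of permutations serves all scales.
  choose τ hτ using fun N i ↦ Finite.exists_min fun k ↦ dist (m N i) (x k)
  have hclose : ∀ s, 0 < s → ∀ᶠ N in atTop, ∀ i, dist (m N i) (x (τ N i)) < s := by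
    intro s hs
    filter_upwards [h.eventually_concentrated hξ₁ hsep hkl hs one_pos] with N hN i
    obtain ⟨k, hk, -⟩ := hN i
    exact (hτ N i k).trans_lt hk
  -- Two components within `ξ₂ / 2` of the same solution would violate the separation of the means.
  have hinj : ∀ᶠ N in atTop, Function.Injective (τ N) := by
    filter_upwards [hclose (ξ₂ / 2) (by positivity), eventually_ge_atTop 1] with N hN hN1 i j hij
    by_contra hne
    have h1 := (hsep N hN1).le_dist i j hne
    have h2 := hN j
    rw [← hij] at h2
    rw [← dist_eq_norm] at h1
    linarith [hN i, dist_triangle_right (m N i) (m N j) (x (τ N i))]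
  classical
  -- The identity is a default value, used for only finitely many `N`.
  let σ : ℕ → Equiv.Perm (Fin n) := fun N ↦
    if hb : Function.Injective (τ N) then
      (Equiv.ofBijective (τ N) (Finite.injective_iff_bijective.1 hb)).symm else 1
  have hσ : ∀ᶠ N in atTop, ∀ k, τ N (σ N k) = k := by
    filter_upwards [hinj] with N hN k
    simp only [σ, dif_pos hN]
    exact Equiv.ofBijective_apply_symm_apply (τ N) _ k
  refine ⟨σ, fun k ↦ ⟨?_, fun s hs ↦ ?_⟩⟩
  · refine Metric.tendsto_nhds.2 fun s hs ↦ ?_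
    filter_upwards [hclose s hs, hσ] with N hN hσN
    have := hN (σ N k)
    rwa [hσN k] at this
  · refine tendsto_order.2 ⟨fun a ha ↦ ?_, fun a ha ↦ Eventually.of_forall fun N ↦
      measureReal_le_one.trans_lt ha⟩
    have hs3 : 0 < s / 3 := by positivity
    filter_upwards [h.eventually_concentrated hξ₁ hsep hkl hs3
      (show 0 < (1 - a) / 2 by linarith), hclose _ hs3, hσ] with N hN hcl hσN
    obtain ⟨k', hk', hmass⟩ := hN (σ N k)
    have h1 := hcl (σ N k)
    rw [hσN k] at h1
    -- The point `x k'` need not be `x k` a priori, but both lie within `s / 3` of the mean.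
    have hsub : Metric.ball (x k') (s / 3) ⊆ Metric.ball (x k) s :=
      Metric.ball_subset_ball' (by
        linarith [dist_triangle_left (x k') (x k) (m N (σ N k))])
    have h2 := measureReal_mono
      (μ := multivariateGaussian (m N (σ N k)) (S N (σ N k))) hsub
    linarith

/-- If the `k`-th component concentrates at `xₖ`, then its rescaled characteristic function,
multiplied by its weight, converges. -/
lemma tendsto_weight_smul_integral (h : IsMultiwell G V₀ xt x) (hξ₁ : 0 < ξ₁)
    (hsep : ∀ N, 1 ≤ N → IsSeparated ξ₁ ξ₂ (α N) (m N) (S N))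
    (hkl : Tendsto (fun N ↦ klDiv (mixture (α N) (m N) (S N))
      (smallNoisePosterior G V₀ xt η N)) atTop (𝓝 0))
    (hconc : ∀ k s, 0 < s → Tendsto (fun N ↦ (multivariateGaussian (m N k) (S N k)).real
      (Metric.ball (x k) s)) atTop (𝓝 1)) (k : Fin n) (t : EuclideanSpace ℝ (Fin d)) :
    Tendsto (fun N ↦ α N k • ∫ z, Complex.exp (inner ℝ (√(N : ℝ) • (z - x k)) t * Complex.I)
        ∂multivariateGaussian (m N k) (S N k)) atTop
      (𝓝 (limitWeight G V₀ x k • charFun (multivariateGaussian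
        (toEuclideanCLM (𝕜 := ℝ) (jacobian G (x k))⁻¹ η) (limitCov G (x k))) t)) := by
  obtain ⟨r, ⟨hloc, hdisj⟩, hr⟩ :=
    ((h.eventually_local.and h.eventually_disjoint).and self_mem_nhdsWithin).exists
  have hr0 : 0 < r := hr
  set P : ℕ → Fin n → Measure (EuclideanSpace ℝ (Fin d)) := fun N l ↦
    multivariateGaussian (m N l) (S N l) with hP
  set B := Metric.ball (x k) r with hB
  set e : ℕ → EuclideanSpace ℝ (Fin d) → ℂ := fun N z ↦
    Complex.exp (inner ℝ (√(N : ℝ) • (z - x k)) t * Complex.I) with he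
  have hem : ∀ N, Measurable (e N) := fun N ↦ by fun_prop
  have he1 : ∀ N z, ‖e N z‖ ≤ 1 := fun N z ↦ (Complex.norm_exp_ofReal_mul_I _).le
  have hBm : MeasurableSet B := measurableSet_ball
  have hψm : ∀ N, Measurable (B.indicator (e N)) := fun N ↦ (hem N).indicator hBm
  have hψ1 : ∀ N z, ‖B.indicator (e N) z‖ ≤ 1 := fun N z ↦
    (norm_indicator_le_norm_self _ _).trans (he1 N z)
  have h1 := h.tendsto_mixture_sub_posterior hξ₁ hsep hkl hψm hψ1
  have h2 : Tendsto (fun N ↦ ∫ z in B, e N z ∂smallNoisePosterior G V₀ xt η N) atTop _ :=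
    h.tendsto_setIntegral_cexp_posterior η k hr0 (hloc k) t
  have h3 := h1.add h2
  rw [zero_add] at h3
  -- Cutting off to `B` costs the `k`-th component only the mass it has outside `B`; any other
  -- component has in `B` at most the mass missing from its own disjoint ball.
  have hmass : ∀ l, Tendsto (fun N ↦ ‖∫ z, (if l = k then e N z else 0) ∂P N l -
      ∫ z, B.indicator (e N) z ∂P N l‖) atTop (𝓝 0) := by
    intro l
    by_cases hl : l = k
    · subst hl
      have hlim : Tendsto (fun N ↦ 1 - (P N l).real B) atTop (𝓝 0) := by
        simpa using (hconc l r hr0).const_sub 1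
      refine squeeze_zero (fun N ↦ norm_nonneg _) (fun N ↦ ?_) hlim
      have hint : ∀ ψ : EuclideanSpace ℝ (Fin d) → ℂ, Measurable ψ → (∀ z, ‖ψ z‖ ≤ 1) →
          Integrable ψ (P N l) := fun ψ hψ hψ1 ↦
        (integrable_const (1 : ℝ)).mono' hψ.aestronglyMeasurable (ae_of_all _ hψ1)
      simp only [if_true]
      rw [← integral_sub (hint _ (hem N) (he1 N)) (hint _ (hψm N) (hψ1 N))]
      have : ∀ z, e N z - B.indicator (e N) z = Bᶜ.indicator (e N) z := fun z ↦ by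
        rw [Set.indicator_compl]
        rfl
      simp_rw [this]
      rw [← probReal_compl_eq_one_sub hBm]
      exact norm_integral_indicator_le hBm.compl (he1 N)
    · have hlim : Tendsto (fun N ↦ 1 - (P N l).real (Metric.ball (x l) r)) atTop (𝓝 0) := by
        simpa using (hconc l r hr0).const_sub 1
      refine squeeze_zero (fun N ↦ norm_nonneg _) (fun N ↦ ?_) hlim
      simp only [hl, if_false, integral_zero, zero_sub, norm_neg]
      refine (norm_integral_indicator_le hBm (he1 N)).trans ?_
      rw [← probReal_compl_eq_one_sub measurableSet_ball]
      exact measureReal_mono (hdisj (Ne.symm hl)).subset_compl_right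
  have hterm : ∀ l, Tendsto (fun N ↦ α N l • (∫ z, (if l = k then e N z else 0) ∂P N l -
      ∫ z, B.indicator (e N) z ∂P N l)) atTop (𝓝 0) := by
    intro l
    refine squeeze_zero_norm' ?_ (hmass l)
    filter_upwards [eventually_ge_atTop 1] with N hN
    have hs := hsep N hN
    rw [norm_smul, Real.norm_of_nonneg (hξ₁.le.trans (hs.le_weight l))]
    exact mul_le_of_le_one_left (norm_nonneg _) (hs.weight_le_one hξ₁ l)
  have h4 := tendsto_finsetSum Finset.univ fun l _ ↦ hterm l
  rw [Finset.sum_const_zero] at h4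
  have h5 := h4.add h3
  rw [zero_add] at h5
  refine h5.congr' ?_
  filter_upwards [eventually_ge_atTop 1] with N hN
  have hs := hsep N hN
  have h6 : ∑ l, α N l • ∫ z, (if l = k then e N z else 0) ∂P N l =
      α N k • ∫ z, e N z ∂P N k := by
    rw [Finset.sum_eq_single k (fun l _ hl ↦ by simp [hl]) (by simp)]
    simp
  rw [integral_mixture (fun l ↦ hξ₁.le.trans (hs.le_weight l)) (hψm N) (hψ1 N),
    integral_indicator hBm]
  rw [Finset.sum_congr rfl fun l _ ↦ smul_sub _ _ _, Finset.sum_sub_distrib, h6]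
  have hcancel : ∀ a b c : ℂ, a - b + (b - c + c) = a := fun a b c ↦ by ring
  exact hcancel _ _ _

/-- The mean and the centre `z₀` contribute only phases, so the modulus isolates the covariance; the
scaling `√N` cancels the factor `1/N`. -/
lemma norm_integral_cexp_multivariateGaussian {N : ℕ} (hN : 1 ≤ N)
    {C : Matrix (Fin d) (Fin d) ℝ} (hC : ((1 / (N : ℝ)) • C).PosSemidef)
    (μ z₀ t : EuclideanSpace ℝ (Fin d)) :
    ‖∫ z, Complex.exp (inner ℝ (√(N : ℝ) • (z - z₀)) t * Complex.I)
      ∂multivariateGaussian μ ((1 / (N : ℝ)) • C)‖ = Real.exp (-(t ⬝ᵥ C *ᵥ t / 2)) := by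
  have hN0 : (0 : ℝ) < N := by exact_mod_cast hN
  have h1 : ∀ z, Complex.exp (inner ℝ (√(N : ℝ) • (z - z₀)) t * Complex.I) =
      Complex.exp ((-inner ℝ (√(N : ℝ) • z₀) t : ℝ) * Complex.I) *
        Complex.exp (inner ℝ z (√(N : ℝ) • t) * Complex.I) := by
    intro z
    rw [← Complex.exp_add, ← add_mul, ← Complex.ofReal_add, smul_sub, inner_sub_left,
      real_inner_smul_left z, real_inner_smul_right, neg_add_eq_sub]
  simp_rw [h1]
  rw [integral_const_mul, norm_mul, Complex.norm_exp_ofReal_mul_I, one_mul, ← charFun_apply,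
    charFun_multivariateGaussian hC, Complex.norm_exp]
  congr 1
  have h2 : (√(N : ℝ) • t).ofLp ⬝ᵥ ((1 / (N : ℝ)) • C) *ᵥ (√(N : ℝ) • t).ofLp =
      t.ofLp ⬝ᵥ C *ᵥ t.ofLp := by
    simp only [WithLp.ofLp_smul, smul_mulVec, mulVec_smul, smul_dotProduct, dotProduct_smul,
      smul_eq_mul]
    have := Real.mul_self_sqrt hN0.le
    field_simp
    rw [Real.sq_sqrt hN0.le]
  rw [h2]
  simp

/-- Convergence of the parameters of separated mixtures whose divergence from the posterior
vanishes. -/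
theorem exists_perm_tendsto (h : IsMultiwell G V₀ xt x) (hξ₁ : 0 < ξ₁) (hξ₂ : 0 < ξ₂)
    (hsep : ∀ N, 1 ≤ N → IsSeparated ξ₁ ξ₂ (α N) (m N) (fun i ↦ (1 / (N : ℝ)) • S N i))
    (hkl : Tendsto (fun N ↦ klDiv (mixture (α N) (m N) (fun i ↦ (1 / (N : ℝ)) • S N i))
      (smallNoisePosterior G V₀ xt η N)) atTop (𝓝 0)) :
    ∃ σ : ℕ → Equiv.Perm (Fin n), ∀ i,
      Tendsto (fun N ↦ m N (σ N i)) atTop (𝓝 (x i)) ∧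
      Tendsto (fun N ↦ S N (σ N i)) atTop (𝓝 (limitCov G (x i))) ∧
      Tendsto (fun N ↦ α N (σ N i)) atTop (𝓝 (limitWeight G V₀ x i)) := by
  obtain ⟨σ, hσ⟩ := h.exists_perm (S := fun N i ↦ (1 / (N : ℝ)) • S N i) hξ₁ hξ₂ hsep hkl
  have hsep' : ∀ N, 1 ≤ N → IsSeparated ξ₁ ξ₂ (fun i ↦ α N (σ N i)) (fun i ↦ m N (σ N i))
      (fun i ↦ (1 / (N : ℝ)) • S N (σ N i)) := fun N hN ↦ (hsep N hN).comp_perm (σ N)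
  have hkl' : Tendsto (fun N ↦ klDiv (mixture (fun i ↦ α N (σ N i)) (fun i ↦ m N (σ N i))
      (fun i ↦ (1 / (N : ℝ)) • S N (σ N i))) (smallNoisePosterior G V₀ xt η N)) atTop (𝓝 0) := by
    refine hkl.congr fun N ↦ ?_
    rw [← mixture_comp_perm (σ N)]
  have hchar := h.tendsto_weight_smul_integral (S := fun N i ↦ (1 / (N : ℝ)) • S N (σ N i))
    hξ₁ hsep' hkl' (fun k ↦ (hσ k).2)
  have hweight : ∀ i, Tendsto (fun N ↦ α N (σ N i)) atTop (𝓝 (limitWeight G V₀ x i)) := by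
    intro i
    -- At frequency `0` both characteristic functions equal one and only the weights remain.
    have h1 := (Complex.continuous_re.tendsto _).comp (hchar i 0)
    simpa [Function.comp_def, charFun_zero] using h1
  refine ⟨σ, fun i ↦ ⟨(hσ i).1, ?_, hweight i⟩⟩
  have hβ := h.limitWeight_pos i
  have hC := posSemidef_inv_gram (jacobian G (x i))
  refine tendsto_of_tendsto_quadratic ?_ (isSymm_of_posSemidef hC) fun t ↦ ?_
  · filter_upwards [eventually_ge_atTop 1] with N hN
    have hN0 : (N : ℝ) ≠ 0 := by positivity
    have h1 := (isSymm_of_posSemidef ((hsep' N hN).posSemidef i)).smul (N : ℝ)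
    rwa [smul_smul, mul_one_div_cancel hN0, one_smul] at h1
  -- Divide by the weight, whose limit is positive, and take moduli; the logarithm then recovers the
  -- quadratic form.
  · have h1 := (((hweight i).inv₀ hβ.ne').smul (hchar i (WithLp.toLp 2 t))).norm
    rw [smul_smul, inv_mul_cancel₀ hβ.ne', one_smul,
      charFun_multivariateGaussian (by exact hC), Complex.norm_exp] at h1
    have h2 : Tendsto (fun N ↦ Real.exp (-(t ⬝ᵥ S N (σ N i) *ᵥ t / 2))) atTop
        (𝓝 (Real.exp (-(t ⬝ᵥ limitCov G (x i) *ᵥ t / 2)))) := by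
      convert h1.congr' ?_ using 2
      · simp
      · filter_upwards [eventually_ge_atTop 1] with N hN
        have hα : α N (σ N i) ≠ 0 := (hξ₁.trans_le ((hsep' N hN).le_weight i)).ne'
        rw [smul_smul, inv_mul_cancel₀ hα, one_smul]
        exact norm_integral_cexp_multivariateGaussian hN ((hsep' N hN).posSemidef i) _ _ _
    have h3 := (h2.log (Real.exp_pos _).ne').const_mul (-2)
    simp only [Real.log_exp] at h3
    convert h3 using 2 <;> ring

end IsMultiwell

-- Admissibility of the competitor and the case of one component

lemma det_jacobian_ne_zero {z : EuclideanSpace ℝ (Fin d)}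
    (hG : IsLocalDiffeomorphAt 𝓘(ℝ, EuclideanSpace ℝ (Fin d)) 𝓘(ℝ, EuclideanSpace ℝ (Fin d)) 1
      G z) : (jacobian G z).det ≠ 0 := by
  have h := hG.mfderivToContinuousLinearEquiv_coe one_ne_zero
  rw [mfderiv_eq_fderiv] at h
  let A : EuclideanSpace ℝ (Fin d) ≃L[ℝ] EuclideanSpace ℝ (Fin d) :=
    hG.mfderivToContinuousLinearEquiv one_ne_zero
  have hA : (A : EuclideanSpace ℝ (Fin d) →L[ℝ] EuclideanSpace ℝ (Fin d)) = fderiv ℝ G z := h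
  rw [jacobian, LinearMap.det_toMatrix, ← hA]
  exact (LinearEquiv.isUnit_det' A.toLinearEquiv).ne_zero

lemma tendsto_competitorMean (j : Fin n) :
    Tendsto (fun N ↦ competitorMean G η x N j) atTop (𝓝 (x j)) :=
  tendsto_add_inv_sqrt_smul _ _

namespace IsMultiwell

variable {ξ₁ ξ₂ : ℝ}

/-- The means converge to the solutions, whose distances exceed `ξ₂` strictly, so the separation
holds for large `N`. -/
lemma eventually_competitor_mem (h : IsMultiwell G V₀ xt x) (η : EuclideanSpace ℝ (Fin d))
    (hξ₁ : ∀ i, ξ₁ ≤ limitWeight G V₀ x i) (hξ₂ : ∀ i j, i ≠ j → ξ₂ < ‖x i - x j‖) :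
    ∀ᶠ N : ℕ in atTop, mixture (limitWeight G V₀ x) (competitorMean G η x N)
      (fun j ↦ (1 / (N : ℝ)) • limitCov G (x j)) ∈ separatedMixtures d n ξ₁ ξ₂ := by
  have hdist : ∀ᶠ N : ℕ in atTop, ∀ i j, i ≠ j →
      ξ₂ ≤ ‖competitorMean G η x N i - competitorMean G η x N j‖ := by
    refine eventually_all.2 fun i ↦ eventually_all.2 fun j ↦ ?_
    by_cases hij : i = j
    · exact Eventually.of_forall fun _ hne ↦ absurd hij hne
    · exact (((tendsto_competitorMean i).sub (tendsto_competitorMean j)).norm.eventually_const_lt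
        (hξ₂ i j hij)).mono fun N hN _ ↦ hN.le
  exact hdist.mono fun N hN ↦ ⟨_, _, _, ⟨hξ₁, h.sum_limitWeight, hN, fun j ↦
    (posSemidef_inv_gram _).smul (by positivity)⟩, rfl⟩

lemma tendsto_klDiv_of_isBestApprox (h : IsMultiwell G V₀ xt x)
    (hξ₁ : ∀ i, ξ₁ ≤ limitWeight G V₀ x i) (hξ₂ : ∀ i j, i ≠ j → ξ₂ < ‖x i - x j‖)
    {ν : ℕ → Measure (EuclideanSpace ℝ (Fin d))}
    (hν : ∀ N, 1 ≤ N → IsBestApprox (separatedMixtures d n ξ₁ ξ₂)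
      (smallNoisePosterior G V₀ xt η N) (ν N)) :
    Tendsto (fun N ↦ klDiv (ν N) (smallNoisePosterior G V₀ xt η N)) atTop (𝓝 0) := by
  refine tendsto_of_tendsto_of_tendsto_of_le_of_le' tendsto_const_nhds
    (h.tendsto_klDiv_competitor η) (Eventually.of_forall fun _ ↦ zero_le) ?_
  filter_upwards [h.eventually_competitor_mem η hξ₁ hξ₂, eventually_ge_atTop 1] with N hN hN1
  exact (hν N hN1).2 hN

end IsMultiwell

lemma mixture_fin_one {α : Fin 1 → ℝ} (hα : ∑ i, α i = 1) (m : Fin 1 → EuclideanSpace ℝ (Fin d))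
    (S : Fin 1 → Matrix (Fin d) (Fin d) ℝ) :
    mixture α m S = multivariateGaussian (m 0) (S 0) := by
  rw [Fin.sum_univ_one] at hα
  rw [mixture, Fin.sum_univ_one, hα, ENNReal.ofReal_one, one_smul]

lemma isSeparated_fin_one {ξ₁ ξ₂ : ℝ} (hξ₁ : ξ₁ ≤ 1) (m : EuclideanSpace ℝ (Fin d))
    {S : Matrix (Fin d) (Fin d) ℝ} (hS : S.PosSemidef) :
    IsSeparated ξ₁ ξ₂ (fun _ : Fin 1 ↦ 1) (fun _ ↦ m) (fun _ ↦ S) where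
  le_weight _ := hξ₁
  sum_weight := by simp
  le_dist i j hij := absurd (Subsingleton.elim i j) hij
  posSemidef _ := hS

/-- With one component the weight must be `1` and separation is vacuous, so approximation by single
Gaussians is an instance of the mixture problem. -/
lemma separatedMixtures_one {ξ₁ ξ₂ : ℝ} (hξ₁ : ξ₁ ≤ 1) :
    separatedMixtures d 1 ξ₁ ξ₂ = gaussianMeasures d := by
  ext ν
  constructor
  · rintro ⟨α, m, S, hsep, rfl⟩
    exact ⟨m 0, S 0, hsep.posSemidef 0, mixture_fin_one hsep.sum_weight m S⟩
  · rintro ⟨m, S, hS, rfl⟩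
    exact ⟨fun _ ↦ 1, fun _ ↦ m, fun _ ↦ S, isSeparated_fin_one hξ₁ m hS,
      (mixture_fin_one (by simp) (fun _ ↦ m) fun _ ↦ S).symm⟩

end KLInverse

open KLInverse in
theorem theorem5p1 {d : ℕ}
    (G : EuclideanSpace ℝ (Fin d) → EuclideanSpace ℝ (Fin d))
    (V₀ : EuclideanSpace ℝ (Fin d) → ℝ)
    (xt η : EuclideanSpace ℝ (Fin d))
    -- the prior: a probability density proportional to `exp (-V₀)`
    (hV₀ : ContDiff ℝ 2 V₀)
    (hV₀_nonneg : ∀ x, 0 ≤ V₀ x)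
    (hV₀_int : Integrable (fun x ↦ Real.exp (-V₀ x)))
    (hG : ContDiff ℝ 4 G)
    -- growth of the potentials
    (hgrowth : ∃ M : ℝ, ∀ x, ‖G x‖ ^ 2 ≤ M * Real.exp (‖x‖ ^ 2) ∧
      V₀ x ≤ M * Real.exp (‖x‖ ^ 2))
    -- `G(x)` does not return to `G(x†)` at infinity
    (hinfty : ∃ R c : ℝ, 0 < c ∧ ∀ x, R ≤ ‖x‖ → c ≤ ‖G x - G xt‖) :
    ((∀ x, G x = G xt → x = xt) →
      IsLocalDiffeomorphAt 𝓘(ℝ, EuclideanSpace ℝ (Fin d)) 𝓘(ℝ, EuclideanSpace ℝ (Fin d)) 1 G xt →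
      ∀ (m : ℕ → EuclideanSpace ℝ (Fin d)) (S : ℕ → Matrix (Fin d) (Fin d) ℝ),
        (∀ N, 1 ≤ N → (S N).PosSemidef ∧
          IsBestApprox (gaussianMeasures d) (smallNoisePosterior G V₀ xt η N)
            (multivariateGaussian (m N) ((1 / (N : ℝ)) • S N))) →
        Tendsto (fun N ↦ klDiv (multivariateGaussian (m N) ((1 / (N : ℝ)) • S N))
          (smallNoisePosterior G V₀ xt η N)) atTop (𝓝 0) ∧
        Tendsto m atTop (𝓝 xt) ∧
        Tendsto S atTop (𝓝 (limitCov G xt))) ∧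
    (∀ (n : ℕ) (x : Fin n → EuclideanSpace ℝ (Fin d)),
      Function.Injective x →
      (∀ z, G z = G xt ↔ ∃ i, x i = z) →
      (∀ i, IsLocalDiffeomorphAt 𝓘(ℝ, EuclideanSpace ℝ (Fin d))
        𝓘(ℝ, EuclideanSpace ℝ (Fin d)) 1 G (x i)) →
      ∀ ξ₁ ξ₂ : ℝ, 0 < ξ₁ → ξ₁ < 1 → (∀ i, ξ₁ ≤ limitWeight G V₀ x i) →
      0 < ξ₂ → (∀ i j, i ≠ j → ξ₂ < ‖x i - x j‖) →
      ∀ (α : ℕ → Fin n → ℝ) (m : ℕ → Fin n → EuclideanSpace ℝ (Fin d))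
        (S : ℕ → Fin n → Matrix (Fin d) (Fin d) ℝ),
        (∀ N, 1 ≤ N → IsSeparated ξ₁ ξ₂ (α N) (m N) (fun i ↦ (1 / (N : ℝ)) • S N i) ∧
          IsBestApprox (separatedMixtures d n ξ₁ ξ₂) (smallNoisePosterior G V₀ xt η N)
            (mixture (α N) (m N) (fun i ↦ (1 / (N : ℝ)) • S N i))) →
        ∃ σ : ℕ → Equiv.Perm (Fin n), ∀ i,
          Tendsto (fun N ↦ m N (σ N i)) atTop (𝓝 (x i)) ∧
          Tendsto (fun N ↦ S N (σ N i)) atTop (𝓝 (limitCov G (x i))) ∧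
          Tendsto (fun N ↦ α N (σ N i)) atTop (𝓝 (limitWeight G V₀ x i))) := by

  have hG1 : ContDiff ℝ 1 G := hG.of_le (by norm_num)
  constructor
  · intro huniq hdiff m S hbest
    have h : IsMultiwell G V₀ xt (fun _ : Fin 1 ↦ xt) :=
      { contDiff := hG1
        continuous := hV₀.continuous
        nonneg := hV₀_nonneg
        integrable := hV₀_int
        growth := hgrowth
        infty := hinfty
        injective := Function.injective_of_subsingleton _
        eq_iff := fun z ↦ ⟨fun hz ↦ ⟨0, (huniq z hz).symm⟩, fun ⟨_, hz⟩ ↦ hz ▸ rfl⟩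
        det_ne_zero := fun _ ↦ det_jacobian_ne_zero hdiff }
    -- The single limiting weight is `1`; the values `ξ₁ = 1 / 2` and `ξ₂ = 1` are arbitrary
    -- choices.
    have hweight : ∀ i, (1 / 2 : ℝ) ≤ limitWeight G V₀ (fun _ : Fin 1 ↦ xt) i := by
      intro i
      have := h.sum_limitWeight
      rw [Fin.sum_univ_one] at this
      rw [Subsingleton.elim i 0, this]
      norm_num
    have hkl := h.tendsto_klDiv_of_isBestApprox (ξ₁ := 1 / 2) (ξ₂ := 1) (η := η) hweight
      (fun i j hij ↦ absurd (Subsingleton.elim i j) hij)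
      (ν := fun N ↦ multivariateGaussian (m N) ((1 / (N : ℝ)) • S N))
      (fun N hN ↦ by
        rw [separatedMixtures_one (by norm_num)]
        exact (hbest N hN).2)
    have hsep : ∀ N : ℕ, 1 ≤ N → IsSeparated (1 / 2) 1 (fun _ : Fin 1 ↦ 1) (fun _ ↦ m N)
        (fun _ ↦ (1 / (N : ℝ)) • S N) := fun N hN ↦
      isSeparated_fin_one (by norm_num) _ ((hbest N hN).1.smul (by positivity))
    obtain ⟨σ, hσ⟩ := h.exists_perm_tendsto (η := η) (α := fun _ _ ↦ 1) (m := fun N _ ↦ m N)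
      (S := fun N _ ↦ S N) (by norm_num) one_pos hsep (by
        refine hkl.congr fun N ↦ ?_
        rw [mixture_fin_one (by simp)])
    exact ⟨hkl, (hσ 0).1, (hσ 0).2.1⟩
  · intro n x hinj heq hdiff ξ₁ ξ₂ hξ₁ _ hweight hξ₂ hdist α m S hbest
    have h : IsMultiwell G V₀ xt x :=
      { contDiff := hG1
        continuous := hV₀.continuous
        nonneg := hV₀_nonneg
        integrable := hV₀_int
        growth := hgrowth
        infty := hinfty
        injective := hinj
        eq_iff := heq
        det_ne_zero := fun i ↦ det_jacobian_ne_zero (hdiff i) }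
    exact h.exists_perm_tendsto (η := η) hξ₁ hξ₂ (fun N hN ↦ (hbest N hN).1)
      (h.tendsto_klDiv_of_isBestApprox hweight hdist fun N hN ↦ (hbest N hN).2)
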